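/- Let $D$ be an ordered division ring and let $\mathcal R=\langle R,<,0,+,\{\lambda\}_{\lambda\in D}\rangle$ be a non-zero ordered vector space over $D$; $R$ has the order topology, $R^n$ the product topology, $cl$ denotes closure, and "definable" means definable in $\mathcal R$ with parameters. For $Y\subseteq R^k$ and functions $f,g$ on $Y$, write $\Gamma(f|_Y)=\{(x,f(x)):x\in Y\}$ and, when $f,g$ may also be the constants $\pm\infty$ and $f<g$ on $Y$, $(f,g)_Y=\{(x,y)\in Y\times R: f(x)<y<g(x)\}$. Cells in $R^n$ are defined inductively: $R^0$ is the only cell in $R^0$, and the cells in $R^{k+1}$ are the sets $\Gamma(f|_Y)$ and $(f,g)_Y$, where $Y$ is a cell in $R^k$ and $f,g$ are continuous definable functions $Y\to R$ (or, in the second case, possibly constants $\pm\infty$), with $f<g$. (So the cells in $R$ are the points and the non-empty open intervals with endpoints in $R\cup\{\pm\infty\}$.) Linear cells are defined in the same way, using only restrictions of functions $x\mapsto \lambda_1x_1+\dots+\lambda_kx_k+a$ with $\lambda_i\in D$, $a\in R$ (and $\pm\infty$). An open cell is a cell that is an open set. A decomposition of $R^{k+1}$ is a finite partition $\mathcal C$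 of $R^{k+1}$ into cells such that $\pi(\mathcal C)=\{\pi(C):C\in\mathcal C\}$ is a decomposition of $R^k$, where $\pi$ is the projection onto the first $k$ coordinates (the only decomposition of $R^0$ is $\{R^0\}$). It is linear if all its members are linear cells. A linear decomposition of $R^n$ with $n\le 1$ is always special; a linear decomposition $\mathcal C$ of $R^{k+1}$, $k>0$, is special if $\pi(\mathcal C)$ is special and, for any cells $\Gamma(h|_A)$ and $(f,g)_B$ in $\mathcal C$ (with $h,f,g$ linear, $f,g$ possibly $\pm\infty$), there is no $c\in cl(A)\cap cl(B)$ with $f(c)<h(c)<g(c)$. $\mathcal C$ partitions $X$ if every member of $\mathcal C$ is contained in $X$ or disjoint from $X$. The star of $Y\subseteq R^n$ is $\mathrm{st}_{\mathcal C}(Y)=\bigcup\{E\in\mathcal C: Y\cap cl(E)\neq\emptyset\}$. Let $X\subseteq R^n$ be a non-empty open definable set. Then $X$ is a finite union of open cells. Moreover, there is a special linear decomposition of $R^n$ that partitions $X$, and for every special linear decomposition $\mathcal C$ of $R^n$ that partitions $X$, $$X=\bigcup_{C\in\mathcal C,\ C\subseteq X}\mathrm{st}_{\mathcal C}(C),$$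 where each of the sets $\mathrm{st}_{\mathcal C}(C)$, $C\in\mathcal C$, $C\subseteq X$, is an open cell. -/

import Mathlib

universe u v

namespace OrderedVectorSpace

section Language

/-- Function symbols of the language of ordered vector spaces over `D`:
`0`, `+` and, for every scalar `c`, multiplication by `c`. -/
inductive FunSymb (D : Type u) : ℕ → Type u
  | zero : FunSymb D 0
  | add : FunSymb D 2
  | smul (c : D) : FunSymb D 1

/-- The only relation symbol of the language of ordered vector spaces: the binary symbol `<`. -/
inductive RelSymb : ℕ → Type
  | lt : RelSymb 2

/-- The first-order language `{<, 0, +} ∪ {c : c ∈ D}`. -/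
def lang (D : Type u) : FirstOrder.Language.{u, 0} := ⟨FunSymb D, RelSymb⟩

/-- An ordered vector space `R` over `D` as the first-order structure
`⟨R, <, 0, +, {c}_{c ∈ D}⟩`. -/
instance structureOn (D : Type u) (R : Type v) [DivisionRing D] [AddCommGroup R]
    [LinearOrder R] [Module D R] : (lang D).Structure R where
  funMap := fun {_} s =>
    match s with
    | FunSymb.zero => fun _ => 0
    | FunSymb.add => fun x => x 0 + x 1
    | FunSymb.smul c => fun x => c • x 0
  RelMap := fun {_} s =>
    match s with
    | RelSymb.lt => fun x => x 0 < x 1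

end Language

section Sets

variable (D : Type u) {R : Type v} [DivisionRing D] [AddCommGroup R] [LinearOrder R] [Module D R]

/-- `X ⊆ R ^ n` is definable, with parameters from `R`, in `⟨R, <, 0, +, {c}_{c ∈ D}⟩`. -/
def IsDefinable {n : ℕ} (X : Set (Fin n → R)) : Prop :=
  (Set.univ : Set R).Definable (lang D) X

/-- The projection `R ^ (n + 1) → R ^ n` onto the first `n` coordinates. -/
def proj {n : ℕ} (z : Fin (n + 1) → R) : Fin n → R := fun i => z i.castSucc

/-- The graph `Γ(f|X) ⊆ R ^ (n + 1)` of the restriction of `f` to `X ⊆ R ^ n`. -/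
def graph {n : ℕ} (X : Set (Fin n → R)) (f : (Fin n → R) → R) : Set (Fin (n + 1) → R) :=
  {z | proj z ∈ X ∧ z (Fin.last n) = f (proj z)}

/-- The cylinder `(f, g)_X = {(x, y) : x ∈ X, f x < y < g x} ⊆ R ^ (n + 1)`; the functions
`f` and `g` may take the values `-∞ = ⊥` and `+∞ = ⊤`. -/
def cylinder {n : ℕ} (X : Set (Fin n → R)) (f g : (Fin n → R) → WithBot (WithTop R)) :
    Set (Fin (n + 1) → R) :=
  {z | proj z ∈ X ∧ f (proj z) < ((z (Fin.last n) : WithTop R) : WithBot (WithTop R)) ∧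
    ((z (Fin.last n) : WithTop R) : WithBot (WithTop R)) < g (proj z)}

/-- A linear (affine) function `f x = c₁ x₁ + ⋯ + cₙ xₙ + a` on `R ^ n`. -/
def IsLinear {n : ℕ} (f : (Fin n → R) → R) : Prop :=
  ∃ (c : Fin n → D) (a : R), ∀ x, f x = (∑ i, c i • x i) + a

/-- A linear function on `R ^ n` or one of the constant functions `-∞`, `+∞`. -/
def IsLinearOrInfinite {n : ℕ} (f : (Fin n → R) → WithBot (WithTop R)) : Prop :=
  (∀ x, f x = ⊥) ∨ (∀ x, f x = ⊤) ∨
    ∃ f₀ : (Fin n → R) → R, IsLinear D f₀ ∧ ∀ x, f x = ((f₀ x : WithTop R) : WithBot (WithTop R))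

/-- Linear cells in `R ^ n`. The one-point space `R ^ 0` is its only cell; so a linear cell in
`R ^ 1` is a singleton or a non-empty open interval with endpoints in `R ∪ {±∞}`. -/
def IsLinearCell : {n : ℕ} → Set (Fin n → R) → Prop
  | 0, Z => Z = Set.univ
  | _ + 1, Z => ∃ X, IsLinearCell X ∧
      ((∃ f, IsLinear D f ∧ Z = graph X f) ∨
        ∃ f g, IsLinearOrInfinite D f ∧ IsLinearOrInfinite D g ∧ (∀ x ∈ X, f x < g x) ∧
          Z = cylinder X f g)

/-- `C` partitions `X`: every member of `C` lies inside `X` or is disjoint from `X`. -/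
def Partitions {n : ℕ} (C : Set (Set (Fin n → R))) (X : Set (Fin n → R)) : Prop :=
  ∀ B ∈ C, B ⊆ X ∨ Disjoint B X

/-- The collection `π(C) = {π(B) : B ∈ C}`. -/
def projAll {n : ℕ} (C : Set (Set (Fin (n + 1) → R))) : Set (Set (Fin n → R)) :=
  (fun B => proj '' B) '' C

variable [TopologicalSpace R]

/-- The restriction of `f` to `X` is a continuous definable function `X → R`. -/
def IsContDef {n : ℕ} (X : Set (Fin n → R)) (f : (Fin n → R) → R) : Prop :=
  ContinuousOn f X ∧ IsDefinable D (graph X f)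

/-- The restriction of `f` to `X` is a continuous definable function `X → R` or one of the
constant functions `-∞`, `+∞`. -/
def IsContDefOrInfinite {n : ℕ} (X : Set (Fin n → R))
    (f : (Fin n → R) → WithBot (WithTop R)) : Prop :=
  (∀ x ∈ X, f x = ⊥) ∨ (∀ x ∈ X, f x = ⊤) ∨
    ∃ f₀ : (Fin n → R) → R, IsContDef D X f₀ ∧
      ∀ x ∈ X, f x = ((f₀ x : WithTop R) : WithBot (WithTop R))

/-- The (usual) cells in `R ^ n` of the structure `⟨R, <, 0, +, {c}_{c ∈ D}⟩`. The one-point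
space `R ^ 0` is its only cell; so a cell in `R ^ 1` is a singleton or a non-empty open interval
with endpoints in `R ∪ {±∞}`. -/
def IsCell : {n : ℕ} → Set (Fin n → R) → Prop
  | 0, Z => Z = Set.univ
  | _ + 1, Z => ∃ X, IsCell X ∧
      ((∃ f, IsContDef D X f ∧ Z = graph X f) ∨
        ∃ f g, IsContDefOrInfinite D X f ∧ IsContDefOrInfinite D X g ∧ (∀ x ∈ X, f x < g x) ∧
          Z = cylinder X f g)

/-- Decompositions of `R ^ n`: finite partitions of `R ^ n` into cells whose projections form a
decomposition of `R ^ (n - 1)`. The only decomposition of the point `R ^ 0` is `{R ^ 0}`; so the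
decompositions of `R ^ 1` are the collections
`(-∞, a₁), {a₁}, (a₁, a₂), …, {aₖ}, (aₖ, +∞)` with `a₁ < ⋯ < aₖ`. -/
def IsDecomposition : {n : ℕ} → Set (Set (Fin n → R)) → Prop
  | 0, C => C = {Set.univ}
  | _ + 1, C => C.Finite ∧ C.PairwiseDisjoint id ∧ ⋃₀ C = Set.univ ∧ (∀ B ∈ C, IsCell D B) ∧
      IsDecomposition (projAll C)

/-- A linear decomposition: a decomposition all of whose members are linear cells. -/
def IsLinearDecomposition {n : ℕ} (C : Set (Set (Fin n → R))) : Prop :=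
  IsDecomposition D C ∧ ∀ B ∈ C, IsLinearCell D B

/-- Special linear decompositions. Every linear decomposition of `R ^ n`, `n ≤ 1`, is special. A
linear decomposition `C` of `R ^ (k + 1)`, `k > 0`, is special if `π(C)` is special and, for all
cells `Γ(h|A)` and `(f, g)_B` in `C`, there is no `c ∈ cl(A) ∩ cl(B)` with `f c < h c < g c`. -/
def IsSpecial : {n : ℕ} → Set (Set (Fin n → R)) → Prop
  | 0, C => IsLinearDecomposition D C
  | 1, C => IsLinearDecomposition D C
  | _ + 2, C => IsLinearDecomposition D C ∧ IsSpecial (projAll C) ∧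
      ∀ A B h f g, IsLinear D h → IsLinearOrInfinite D f → IsLinearOrInfinite D g →
        (∀ x ∈ B, f x < g x) → graph A h ∈ C → cylinder B f g ∈ C →
        ¬ ∃ c ∈ closure A ∩ closure B,
          f c < ((h c : WithTop R) : WithBot (WithTop R)) ∧
            ((h c : WithTop R) : WithBot (WithTop R)) < g c

/-- The star `st_C(X)`: the union of all `B ∈ C` whose closure meets `X`. -/
def star {n : ℕ} (C : Set (Set (Fin n → R))) (X : Set (Fin n → R)) : Set (Fin n → R) :=
  ⋃₀ {B ∈ C | (X ∩ closure B).Nonempty}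

end Sets

end OrderedVectorSpace

/-!
A definable set is described by the signs of finitely many linear functions (quantifier
elimination, `IsDefinable.isSignDetermined`). Given finitely many linear functions on
`R ^ (n + 1)`, solve those that involve the last coordinate for it; this gives finitely many
linear functions `h` on `R ^ n`. Over a decomposition of `R ^ n` on whose members the differences
`h - h'` have constant signs, the graphs of the `h` and the cylinders between consecutive ones
form a linear decomposition (`stackOver`). As the `h` are defined on all of `R ^ n`, one that is
strictly between two others at a limit point of a cell is so at points of the cell, and therefore
this decomposition is special (`exists_isSpecial`).

For the stars, let `C` be a special linear decomposition of `R ^ (n + 1)`. Call the linear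
functions whose graphs over `A` belong to `C`, and the constants `±∞`, the walls over `A`. They are
linearly ordered, and each cell over `A` is the graph of a wall or a cylinder between two walls.
Specialness says that, for `A` in the closure of `B`, the walls over `B` restrict to walls over `A`
(`IsWall.restrict`) and every wall over `A` arises in this way (`IsWall.lift`). This yields the
frontier condition: a cell that meets the closure of another one is contained in that closure
(`IsSpecial.subset_closure`). Now let `F` be a cell of `C` with base `A`. Over a cell `B` with `A`
in its closure, the star of `F` is the cylinder between the largest wall below `F` and the smallest
wall above `F` (`mem_star_iff`). As walls restrict and lift, these walls fit together for varying
`B` and form continuous functions on the star of `A` (`exists_isContDefOrInfinite`), which is an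
open cell by induction; hence so is the star of `F`.

Neither `R` nor `D` is assumed to be complete and the topology of `R` is not related to one of `D`:
`t • x` need not tend to `0` with `t`. For this reason connectedness arguments are replaced by the
intermediate value property of linear functions on linear cells (`IsLinear.pos_or_neg`) and by the
pigeonhole principle along segments (`IsLinear.eq_of_forall_exists_eq`).
-/

namespace OrderedVectorSpace

/-! ### Elements of `R ∪ {±∞}` -/

section Extended

variable {R : Type v}

/-- The inclusion of `R` into `R ∪ {±∞}`, with `-∞ = ⊥` and `+∞ = ⊤`. -/
abbrev toExt (y : R) : WithBot (WithTop R) := ((y : WithTop R) : WithBot (WithTop R))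

theorem ext_cases (e : WithBot (WithTop R)) : e = ⊥ ∨ e = ⊤ ∨ ∃ y : R, e = toExt y := by
  induction e using WithBot.recBotCoe with
  | bot => exact Or.inl rfl
  | coe e =>
    induction e using WithTop.recTopCoe with
    | top => exact Or.inr (Or.inl rfl)
    | coe y => exact Or.inr (Or.inr ⟨y, rfl⟩)

theorem toExt_inj {a b : R} : toExt a = toExt b ↔ a = b := by simp [toExt]

variable [LinearOrder R]

theorem toExt_lt {a b : R} : toExt a < toExt b ↔ a < b := by simp [toExt]

theorem toExt_le {a b : R} : toExt a ≤ toExt b ↔ a ≤ b := by simp [toExt]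

theorem bot_lt_toExt (a : R) : ⊥ < toExt a := WithBot.bot_lt_coe _

theorem toExt_lt_top (a : R) : toExt a < ⊤ :=
  WithBot.coe_lt_coe.2 (WithTop.coe_lt_top a)

theorem ext_bot_lt_top : (⊥ : WithBot (WithTop R)) < ⊤ := WithBot.bot_lt_coe _

theorem exists_toExt_between [DenselyOrdered R] [NoMinOrder R] [NoMaxOrder R] [Nonempty R]
    {e e' : WithBot (WithTop R)} (h : e < e') : ∃ y : R, e < toExt y ∧ toExt y < e' := by
  rcases ext_cases e with rfl | rfl | ⟨a, rfl⟩
  · rcases ext_cases e' with rfl | rfl | ⟨b, rfl⟩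
    · exact absurd h (lt_irrefl _)
    · exact ⟨Classical.arbitrary R, bot_lt_toExt _, toExt_lt_top _⟩
    · obtain ⟨y, hy⟩ := exists_lt b
      exact ⟨y, bot_lt_toExt _, toExt_lt.2 hy⟩
  · exact absurd h (not_lt_of_ge le_top)
  · rcases ext_cases e' with rfl | rfl | ⟨b, rfl⟩
    · exact absurd h (not_lt_of_ge bot_le)
    · obtain ⟨y, hy⟩ := exists_gt a
      exact ⟨y, toExt_lt.2 hy, toExt_lt_top _⟩
    · obtain ⟨y, hy, hy'⟩ := exists_between (toExt_lt.1 h)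
      exact ⟨y, toExt_lt.2 hy, toExt_lt.2 hy'⟩

/-- An interval of a dense order without endpoints determines its endpoints. -/
theorem ext_endpoints_eq [DenselyOrdered R] [NoMinOrder R] [NoMaxOrder R] [Nonempty R]
    {e e' d d' : WithBot (WithTop R)} (h : e < e')
    (H : ∀ y : R, (e < toExt y ∧ toExt y < e') ↔ (d < toExt y ∧ toExt y < d')) :
    e = d ∧ e' = d' := by
  obtain ⟨y, hy⟩ := exists_toExt_between h
  have hy' := (H y).1 hy
  refine ⟨le_antisymm ?_ ?_, le_antisymm ?_ ?_⟩ <;> by_contra! hlt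
  · obtain ⟨z, hz, hz'⟩ := exists_toExt_between hlt
    exact lt_asymm hz' ((H z).2 ⟨hz, (hz'.trans hy.1).trans hy'.2⟩).1
  · obtain ⟨z, hz, hz'⟩ := exists_toExt_between hlt
    exact lt_asymm hz' ((H z).1 ⟨hz, (hz'.trans hy'.1).trans hy.2⟩).1
  · obtain ⟨z, hz, hz'⟩ := exists_toExt_between hlt
    exact lt_asymm hz ((H z).1 ⟨(hy.1.trans hy'.2).trans hz, hz'⟩).2
  · obtain ⟨z, hz, hz'⟩ := exists_toExt_between hlt
    exact lt_asymm hz ((H z).2 ⟨(hy'.1.trans hy.2).trans hz, hz'⟩).2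

end Extended

/-! ### Linear functions -/

section Snoc

variable {R : Type v} {n : ℕ}

/-- The point `(x, y)` of `R ^ (n + 1)`. -/
def pair (x : Fin n → R) (y : R) : Fin (n + 1) → R := Fin.snoc (α := fun _ => R) x y

@[simp] theorem proj_pair (x : Fin n → R) (y : R) : proj (pair x y) = x := by
  funext i; simp [proj, pair]

@[simp] theorem pair_last (x : Fin n → R) (y : R) : pair x y (Fin.last n) = y := by simp [pair]

@[simp] theorem pair_proj (z : Fin (n + 1) → R) : pair (proj z) (z (Fin.last n)) = z := by
  funext i
  refine Fin.lastCases ?_ (fun i => ?_) i <;> simp [proj, pair]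

theorem pair_mem_graph {X : Set (Fin n → R)} {f : (Fin n → R) → R} {x : Fin n → R} {y : R} :
    pair x y ∈ graph X f ↔ x ∈ X ∧ y = f x := by
  change proj (pair x y) ∈ X ∧ _ ↔ _
  rw [proj_pair, pair_last]

theorem pair_mem_cylinder [LinearOrder R] {X : Set (Fin n → R)}
    {f g : (Fin n → R) → WithBot (WithTop R)} {x : Fin n → R} {y : R} :
    pair x y ∈ cylinder X f g ↔ x ∈ X ∧ f x < toExt y ∧ toExt y < g x := by
  change proj (pair x y) ∈ X ∧ _ ∧ _ ↔ _
  rw [proj_pair, pair_last]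

theorem proj_image_graph (X : Set (Fin n → R)) (f : (Fin n → R) → R) : proj '' graph X f = X := by
  ext x
  constructor
  · rintro ⟨z, hz, rfl⟩
    exact hz.1
  · intro hx
    exact ⟨pair x (f x), pair_mem_graph.2 ⟨hx, rfl⟩, proj_pair _ _⟩

theorem graph_eq_graph_iff {X : Set (Fin n → R)} {f g : (Fin n → R) → R} :
    graph X f = graph X g ↔ ∀ x ∈ X, f x = g x := by
  constructor
  · intro h x hx
    have : pair x (f x) ∈ graph X g := h ▸ pair_mem_graph.2 ⟨hx, rfl⟩
    exact (pair_mem_graph.1 this).2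
  · intro h
    ext z
    exact and_congr_right fun hz => by rw [h _ hz]

theorem cylinder_congr [LinearOrder R] {X : Set (Fin n → R)}
    {f g f' g' : (Fin n → R) → WithBot (WithTop R)}
    (hf : ∀ x ∈ X, f x = f' x) (hg : ∀ x ∈ X, g x = g' x) : cylinder X f g = cylinder X f' g' := by
  ext z
  exact and_congr_right fun hz => by rw [hf _ hz, hg _ hz]

end Snoc

section Linear

variable {D : Type u} {R : Type v} [DivisionRing D] [AddCommGroup R] [Module D R] {n : ℕ}

theorem isLinear_const (a : R) : IsLinear D (fun _ : Fin n → R => a) :=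
  ⟨0, a, fun x => by simp⟩

theorem isLinear_apply (i : Fin n) : IsLinear D (fun x : Fin n → R => x i) :=
  ⟨Pi.single i 1, 0, fun x => by
    rw [Finset.sum_eq_single i] <;> simp +contextual⟩

theorem IsLinear.add {f g : (Fin n → R) → R} (hf : IsLinear D f) (hg : IsLinear D g) :
    IsLinear D (fun x => f x + g x) := by
  obtain ⟨c, a, hf⟩ := hf
  obtain ⟨d, b, hg⟩ := hg
  refine ⟨c + d, a + b, fun x => ?_⟩
  simp only [hf, hg, Pi.add_apply, add_smul, Finset.sum_add_distrib]
  abel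

theorem IsLinear.smul {f : (Fin n → R) → R} (r : D) (hf : IsLinear D f) :
    IsLinear D (fun x => r • f x) := by
  obtain ⟨c, a, hf⟩ := hf
  refine ⟨fun i => r * c i, r • a, fun x => ?_⟩
  simp only [hf, smul_add, Finset.smul_sum, mul_smul]

theorem IsLinear.sub {f g : (Fin n → R) → R} (hf : IsLinear D f) (hg : IsLinear D g) :
    IsLinear D (fun x => f x - g x) := by
  have := hf.add (hg.smul (-1))
  simpa [sub_eq_add_neg] using this

/-- A linear function on `R ^ (n + 1)` splits into a linear function on `R ^ n` and a multiple of
the last coordinate. -/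
theorem IsLinear.exists_split {f : (Fin (n + 1) → R) → R} (hf : IsLinear D f) :
    ∃ (f₀ : (Fin n → R) → R) (c : D), IsLinear D f₀ ∧
      ∀ z, f z = f₀ (proj z) + c • z (Fin.last n) := by
  obtain ⟨c, a, hf⟩ := hf
  refine ⟨fun x => (∑ i, c i.castSucc • x i) + a, c (Fin.last n), ⟨_, a, fun x => rfl⟩,
    fun z => ?_⟩
  rw [hf, Fin.sum_univ_castSucc]
  simp only [proj]
  abel

/-- A linear function is an affine function of a central parameter `t` along a segment. For a
parameter that does not commute with the coefficients this would fail. -/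
theorem IsLinear.apply_segment {f : (Fin n → R) → R} (hf : IsLinear D f) (x y : Fin n → R) {t : D}
    (ht : ∀ c, Commute t c) : f (x + t • (y - x)) = f x + t • (f y - f x) := by
  obtain ⟨c, a, hf⟩ := hf
  have h : ∀ i, c i • t • (y i - x i) = t • (c i • y i - c i • x i) := fun i => by
    rw [← mul_smul, ← (ht (c i)).eq, mul_smul, smul_sub]
  simp only [hf, Pi.add_apply, Pi.smul_apply, Pi.sub_apply, smul_add, Finset.sum_add_distrib, h,
    add_sub_add_right_eq_sub, ← Finset.sum_sub_distrib, Finset.smul_sum]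
  abel

theorem IsLinear.isLinearOrInfinite {f : (Fin n → R) → R} (hf : IsLinear D f) :
    IsLinearOrInfinite D (fun x => toExt (f x)) :=
  Or.inr (Or.inr ⟨f, hf, fun _ => rfl⟩)

theorem isLinearOrInfinite_bot : IsLinearOrInfinite D (fun _ : Fin n → R => ⊥) :=
  Or.inl fun _ => rfl

theorem isLinearOrInfinite_top : IsLinearOrInfinite D (fun _ : Fin n → R => ⊤) :=
  Or.inr (Or.inl fun _ => rfl)

theorem IsLinear.comp_proj {f : (Fin n → R) → R} (hf : IsLinear D f) :
    IsLinear D fun z => f (proj z) := by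
  obtain ⟨c, a, hf⟩ := hf
  refine ⟨Fin.snoc (α := fun _ => D) c 0, a, fun z => ?_⟩
  simp [hf, Fin.sum_univ_castSucc, proj]

theorem IsLinearOrInfinite.comp_proj {f : (Fin n → R) → WithBot (WithTop R)}
    (hf : IsLinearOrInfinite D f) : IsLinearOrInfinite D fun z => f (proj z) := by
  obtain hf | hf | ⟨f₀, hl, hf⟩ := hf
  · exact Or.inl fun _ => hf _
  · exact Or.inr (Or.inl fun _ => hf _)
  · exact Or.inr (Or.inr ⟨_, hl.comp_proj, fun _ => hf _⟩)

end Linear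

/-! ### Linear cells -/

section LinearCells

variable {D : Type u} {R : Type v} [DivisionRing D] [AddCommGroup R] [LinearOrder R] [Module D R]
  {n : ℕ}

variable [IsOrderedAddMonoid R]

/-- The step of the induction in `IsLinear.pos_or_neg`: it derives from the intermediate value
property over `A`, stated as the hypothesis `H`, that a linear function whose graph avoids a
cylinder over `A` stays on one side of it. -/
theorem not_between_aux {A : Set (Fin n → R)}
    (H : ∀ u : (Fin n → R) → R, IsLinear D u → (∀ x ∈ A, u x ≠ 0) →
      (∀ x ∈ A, 0 < u x) ∨ (∀ x ∈ A, u x < 0))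
    {f g : (Fin n → R) → WithBot (WithTop R)} (hf : IsLinearOrInfinite D f)
    (hg : IsLinearOrInfinite D g) (hfg : ∀ x ∈ A, f x < g x) {w : (Fin n → R) → R}
    (hw : IsLinear D w) (hn : ∀ x ∈ A, ¬ (f x < toExt (w x) ∧ toExt (w x) < g x)) :
    (∀ x ∈ A, toExt (w x) ≤ f x) ∨ (∀ x ∈ A, g x ≤ toExt (w x)) := by
  obtain hf | hf | ⟨f₀, hfl, hf⟩ := hf
  · right
    intro x hx
    have := hn x hx
    rw [hf] at this
    exact not_lt.1 fun h => this ⟨bot_lt_toExt _, h⟩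
  · left
    intro x _
    rw [hf]
    exact le_top
  obtain hg | hg | ⟨g₀, hgl, hg⟩ := hg
  · right
    intro x _
    rw [hg]
    exact bot_le
  · left
    intro x hx
    have := hn x hx
    rw [hg] at this
    exact not_lt.1 fun h => this ⟨h, toExt_lt_top _⟩
  simp only [hf, hg, toExt_lt, toExt_le] at *
  -- `f + g - 2w` is positive where `w ≤ f` and negative where `g ≤ w`
  have key : ∀ x ∈ A, (w x ≤ f₀ x ∧ 0 < (f₀ x - w x) + (g₀ x - w x)) ∨
      (g₀ x ≤ w x ∧ (f₀ x - w x) + (g₀ x - w x) < 0) := by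
    intro x hx
    by_cases h : w x ≤ f₀ x
    · exact Or.inl ⟨h, add_pos_of_nonneg_of_pos (sub_nonneg.2 h)
        (sub_pos.2 (h.trans_lt (hfg x hx)))⟩
    · have h' : g₀ x ≤ w x := not_lt.1 fun h' => hn x hx ⟨not_le.1 h, h'⟩
      exact Or.inr ⟨h', add_neg_of_neg_of_nonpos (sub_neg.2 (not_le.1 h)) (sub_nonpos.2 h')⟩
  rcases H _ ((hfl.sub hw).add (hgl.sub hw)) (fun x hx => by
    rcases key x hx with h | h
    · exact h.2.ne'
    · exact h.2.ne) with h | h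
  · exact Or.inl fun x hx => ((key x hx).resolve_right fun h' => lt_asymm h'.2 (h x hx)).1
  · exact Or.inr fun x hx => ((key x hx).resolve_left fun h' => lt_asymm h'.2 (h x hx)).1

variable [LinearOrder D] [IsStrictOrderedRing D] [IsStrictOrderedModule D R]

/-- A vector space over an ordered division ring is densely ordered, as it has midpoints. -/
theorem denselyOrdered_of_module (D : Type u) (R : Type v) [DivisionRing D] [AddCommGroup R]
    [LinearOrder R] [Module D R] [LinearOrder D] [IsStrictOrderedRing D] [IsOrderedAddMonoid R]
    [IsStrictOrderedModule D R] : DenselyOrdered R := by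
  refine ⟨fun a b hab => ⟨(2⁻¹ : D) • (a + b), ?_, ?_⟩⟩
  · have h : a = (2⁻¹ : D) • (a + a) := by
      rw [← two_smul D a, smul_smul, inv_mul_cancel₀ two_ne_zero, one_smul]
    nth_rw 1 [h]
    exact smul_lt_smul_of_pos_left (by gcongr) (by positivity)
  · have h : b = (2⁻¹ : D) • (b + b) := by
      rw [← two_smul D b, smul_smul, inv_mul_cancel₀ two_ne_zero, one_smul]
    nth_rw 2 [h]
    exact smul_lt_smul_of_pos_left (by gcongr) (by positivity)

theorem segment_lt {a b c d : R} {t : D} (h : a < b) (h' : c < d) (t0 : 0 < t) (t1 : t ≤ 1) :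
    a + t • (c - a) < b + t • (d - b) := by
  have e1 : 0 < t • (d - c) := smul_pos t0 (sub_pos.2 h')
  have e2 : 0 ≤ (1 - t) • (b - a) := smul_nonneg (sub_nonneg.2 t1) (sub_pos.2 h).le
  have e3 : b + t • (d - b) - (a + t • (c - a)) = t • (d - c) + (1 - t) • (b - a) := by
    simp only [sub_smul, smul_sub, one_smul]; abel
  rw [← sub_pos, e3]
  exact add_pos_of_pos_of_nonneg e1 e2

theorem IsLinearOrInfinite.lt_segment {f : (Fin n → R) → WithBot (WithTop R)}
    (hf : IsLinearOrInfinite D f) {x y : Fin n → R} {a b : R} {t : D} (t0 : 0 < t) (t1 : t ≤ 1)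
    (ht : ∀ c, Commute t c) (h : f x < toExt a) (h' : f y < toExt b) :
    f (x + t • (y - x)) < toExt (a + t • (b - a)) := by
  obtain hf | hf | ⟨f₀, hl, hf⟩ := hf
  · rw [hf]; exact bot_lt_toExt _
  · rw [hf] at h; exact absurd h (not_lt_of_ge le_top)
  · rw [hf] at h h' ⊢
    rw [toExt_lt] at *
    rw [hl.apply_segment x y ht]
    exact segment_lt h h' t0 t1

theorem IsLinearOrInfinite.segment_lt {f : (Fin n → R) → WithBot (WithTop R)}
    (hf : IsLinearOrInfinite D f) {x y : Fin n → R} {a b : R} {t : D} (t0 : 0 < t) (t1 : t ≤ 1)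
    (ht : ∀ c, Commute t c) (h : toExt a < f x) (h' : toExt b < f y) :
    toExt (a + t • (b - a)) < f (x + t • (y - x)) := by
  obtain hf | hf | ⟨f₀, hl, hf⟩ := hf
  · rw [hf] at h; exact absurd h (not_lt_of_ge bot_le)
  · rw [hf]; exact toExt_lt_top _
  · rw [hf] at h h' ⊢
    rw [toExt_lt] at *
    rw [hl.apply_segment x y ht]
    exact OrderedVectorSpace.segment_lt h h' t0 t1

/-- Linear cells are convex, at least with respect to central parameters. -/
theorem IsLinearCell.segment_mem {n : ℕ} {Z : Set (Fin n → R)} (hZ : IsLinearCell D Z)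
    {x y : Fin n → R} (hx : x ∈ Z) (hy : y ∈ Z) {t : D} (t0 : 0 < t) (t1 : t ≤ 1)
    (ht : ∀ c, Commute t c) : x + t • (y - x) ∈ Z := by
  induction n with
  | zero => rw [show Z = Set.univ from hZ]; trivial
  | succ n ih =>
    obtain ⟨X, hX, ⟨f, hf, rfl⟩ | ⟨f, g, hf, hg, -, rfl⟩⟩ := hZ
    · have hp : proj (x + t • (y - x)) = proj x + t • (proj y - proj x) := rfl
      refine ⟨hp ▸ ih hX hx.1 hy.1, ?_⟩
      rw [hp, hf.apply_segment _ _ ht, ← hx.2, ← hy.2]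
      rfl
    · have hp : proj (x + t • (y - x)) = proj x + t • (proj y - proj x) := rfl
      refine ⟨hp ▸ ih hX hx.1 hy.1, ?_, ?_⟩
      · rw [hp]; exact hf.lt_segment t0 t1 ht hx.2.1 hy.2.1
      · rw [hp]; exact hg.segment_lt t0 t1 ht hx.2.2 hy.2.2

variable [Nontrivial R]

theorem proj_image_cylinder (D : Type u) [DivisionRing D] [LinearOrder D] [IsStrictOrderedRing D]
    [Module D R] [IsStrictOrderedModule D R] {X : Set (Fin n → R)}
    {f g : (Fin n → R) → WithBot (WithTop R)} (h : ∀ x ∈ X, f x < g x) :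
    proj '' cylinder X f g = X := by
  have := denselyOrdered_of_module D R
  ext x
  constructor
  · rintro ⟨z, hz, rfl⟩
    exact hz.1
  · intro hx
    obtain ⟨y, hy⟩ := exists_toExt_between (h x hx)
    exact ⟨pair x y, pair_mem_cylinder.2 ⟨hx, hy⟩, proj_pair _ _⟩

/-- A graph is never a cylinder, as the fibres of the latter have more than one point. -/
theorem graph_ne_cylinder (D : Type u) [DivisionRing D] [LinearOrder D] [IsStrictOrderedRing D]
    [Module D R] [IsStrictOrderedModule D R] {X Y : Set (Fin n → R)} (hY : Y.Nonempty)
    {h : (Fin n → R) → R} {f g : (Fin n → R) → WithBot (WithTop R)} (hfg : ∀ x ∈ Y, f x < g x) :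
    graph X h ≠ cylinder Y f g := by
  have := denselyOrdered_of_module D R
  intro H
  obtain ⟨x, hx⟩ := hY
  obtain ⟨y, hy, hy'⟩ := exists_toExt_between (hfg x hx)
  obtain ⟨y', h1, h2⟩ := exists_toExt_between hy'
  have e : pair x y ∈ graph X h := H ▸ pair_mem_cylinder.2 ⟨hx, hy, hy'⟩
  have e' : pair x y' ∈ graph X h := H ▸ pair_mem_cylinder.2 ⟨hx, hy.trans h1, h2⟩
  rw [pair_mem_graph] at e e'
  rw [e.2, e'.2] at h1
  exact lt_irrefl _ h1

theorem IsLinearCell.nonempty {n : ℕ} {Z : Set (Fin n → R)} (hZ : IsLinearCell D Z) :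
    Z.Nonempty := by
  induction n with
  | zero => rw [show Z = Set.univ from hZ]; exact Set.univ_nonempty
  | succ n ih =>
    obtain ⟨X, hX, ⟨f, _, rfl⟩ | ⟨f, g, _, _, h, rfl⟩⟩ := hZ
    · exact Set.image_nonempty.1 ((proj_image_graph X f).symm ▸ ih hX)
    · exact Set.image_nonempty.1 ((proj_image_cylinder D h).symm ▸ ih hX)

/-- A linear function that at each point of a linear cell `A` agrees with one of finitely many
linear functions, no two of which meet over `A`, agrees with a single one of them on `A`: on the
segment between two points of `A` it agrees infinitely often with the same one. -/
theorem IsLinear.eq_of_forall_exists_eq {A : Set (Fin n → R)} (hA : IsLinearCell D A)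
    {C : Set (Set (Fin (n + 1) → R))} (hfin : C.Finite) (hdisj : C.PairwiseDisjoint id)
    {f : (Fin n → R) → R} (hf : IsLinear D f)
    (H : ∀ x ∈ A, ∃ h, IsLinear D h ∧ graph A h ∈ C ∧ f x = h x) :
    ∃ h, IsLinear D h ∧ graph A h ∈ C ∧ ∀ x ∈ A, f x = h x := by
  obtain ⟨x, hx⟩ := hA.nonempty
  obtain ⟨h₀, hl₀, hC₀, he₀⟩ := H x hx
  refine ⟨h₀, hl₀, hC₀, fun y hy => ?_⟩
  let t : ℕ → D := fun m => ((m : D) + 1)⁻¹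
  have t0 : ∀ m, 0 < t m := fun m => inv_pos.2 (by positivity)
  have t1 : ∀ m, t m ≤ 1 := fun m => inv_le_one_of_one_le₀ (by simp)
  have ht : ∀ m c, Commute (t m) c := fun m c =>
    (((Nat.cast_commute m c).add_left (Commute.one_left c))).inv_left₀
  have hmem : ∀ m, x + t m • (y - x) ∈ A := fun m => hA.segment_mem hx hy (t0 m) (t1 m) (ht m)
  choose h hl hC he using fun m => H _ (hmem m)
  obtain ⟨m, -, m', -, hne, heq⟩ := Set.infinite_univ.exists_ne_map_eq_of_mapsTo
    (f := fun m => graph A (h m)) (t := C) (fun m _ => hC m) hfin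
  have hmm : ∀ z ∈ A, h m z = h m' z := graph_eq_graph_iff.1 heq
  have e1 := he m
  have e2 := he m'
  rw [← hmm _ (hmem m')] at e2
  rw [hf.apply_segment _ _ (ht _), (hl m).apply_segment _ _ (ht _)] at e1 e2
  -- the difference of `f` and `h m` is `p + t • q` along the segment, with two zeros
  set p := f x - h m x with hp
  set q := (f y - f x) - (h m y - h m x) with hq
  have e1' : p + t m • q = 0 := by
    rw [hp, hq, smul_sub, ← sub_eq_zero.2 e1]; abel
  have e2' : p + t m' • q = 0 := by
    rw [hp, hq, smul_sub, ← sub_eq_zero.2 e2]; abel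
  have e3 : (t m - t m') • q = 0 := by
    rw [sub_smul, sub_eq_zero]; exact add_left_cancel (e1'.trans e2'.symm)
  have htne : t m - t m' ≠ 0 := by
    intro h0
    have := inv_injective (sub_eq_zero.1 h0)
    exact hne (by exact_mod_cast add_right_cancel this)
  have hq0 : q = 0 := (smul_eq_zero.1 e3).resolve_left htne
  have hp0 : p = 0 := by simpa [hq0] using e1'
  have hfx : f x = h m x := sub_eq_zero.1 hp0
  have hfy : f y = h m y := by
    have := sub_eq_zero.1 hq0
    rwa [hfx, sub_left_inj] at this
  have hG : graph A h₀ = graph A (h m) := by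
    refine hdisj.elim_set hC₀ (hC m) (pair x (f x)) ?_ ?_
    · exact pair_mem_graph.2 ⟨hx, he₀⟩
    · exact pair_mem_graph.2 ⟨hx, hfx⟩
  rw [hfy, graph_eq_graph_iff.1 hG y hy]

/-- The intermediate value property of linear functions on linear cells. As the scalars need not
be complete, it cannot be had from segments; it is proved by induction on the dimension. -/
theorem IsLinear.pos_or_neg {n : ℕ} {A : Set (Fin n → R)} (hA : IsLinearCell D A)
    {u : (Fin n → R) → R} (hu : IsLinear D u) (h0 : ∀ x ∈ A, u x ≠ 0) :
    (∀ x ∈ A, 0 < u x) ∨ (∀ x ∈ A, u x < 0) := by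
  induction n with
  | zero =>
    rcases lt_or_gt_of_ne (h0 default (by rw [show A = Set.univ from hA]; trivial)) with h | h
    · exact Or.inr fun x _ => Subsingleton.elim default x ▸ h
    · exact Or.inl fun x _ => Subsingleton.elim default x ▸ h
  | succ n ih =>
    obtain ⟨u₀, c, hl, hs⟩ := hu.exists_split
    obtain ⟨X, hX, ⟨f, hf, rfl⟩ | ⟨f, g, hf, hg, hfg, rfl⟩⟩ := hA
    · have e : ∀ z ∈ graph X f, u z = u₀ (proj z) + c • f (proj z) := fun z hz => by
        rw [hs, hz.2]
      rcases ih hX (hl.add (hf.smul c)) (fun x hx => by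
        have := h0 _ (pair_mem_graph.2 ⟨hx, rfl⟩)
        rwa [hs, proj_pair, pair_last] at this) with h | h
      · exact Or.inl fun z hz => e z hz ▸ h _ hz.1
      · exact Or.inr fun z hz => e z hz ▸ h _ hz.1
    · rcases eq_or_ne c 0 with rfl | hc
      · simp only [zero_smul, add_zero] at hs
        have hp := proj_image_cylinder D hfg
        rcases ih hX hl (fun x hx => by
          rw [← hp] at hx
          obtain ⟨z, hz, rfl⟩ := hx
          exact hs z ▸ h0 z hz) with h | h
        · exact Or.inl fun z hz => hs z ▸ h _ hz.1
        · exact Or.inr fun z hz => hs z ▸ h _ hz.1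
      · -- `u` vanishes exactly on the graph of `w`
        set w : (Fin n → R) → R := fun x => (-c⁻¹) • u₀ x with hw
        have e : ∀ z, u z = c • (z (Fin.last n) - w (proj z)) := fun z => by
          rw [hs, hw, smul_sub, smul_smul, mul_neg, mul_inv_cancel₀ hc, neg_one_smul]
          abel
        have hlt : (∀ z ∈ cylinder X f g, 0 < z (Fin.last n) - w (proj z)) ∨
            (∀ z ∈ cylinder X f g, z (Fin.last n) - w (proj z) < 0) := by
          rcases not_between_aux (fun u hu h => ih hX hu h) hf hg hfg (hl.smul (-c⁻¹))
            (fun x hx h => h0 (pair x (w x)) (pair_mem_cylinder.2 ⟨hx, h⟩) (by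
              rw [e, proj_pair, pair_last, sub_self, smul_zero])) with h | h
          · exact Or.inl fun z hz => sub_pos.2 (toExt_lt.1 ((h _ hz.1).trans_lt hz.2.1))
          · exact Or.inr fun z hz => sub_neg.2 (toExt_lt.1 (hz.2.2.trans_le (h _ hz.1)))
        simp only [e]
        rcases lt_or_gt_of_ne hc with hc | hc
        · rcases hlt with h | h
          · exact Or.inr fun z hz => smul_neg_of_neg_of_pos hc (h z hz)
          · exact Or.inl fun z hz => smul_pos_of_neg_of_neg hc (h z hz)
        · rcases hlt with h | h
          · exact Or.inl fun z hz => smul_pos hc (h z hz)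
          · exact Or.inr fun z hz => smul_neg_of_pos_of_neg hc (h z hz)

/-- A linear function whose graph avoids a cylinder over a linear cell stays on one side of it. -/
theorem IsLinear.le_or_le_of_not_between {A : Set (Fin n → R)} (hA : IsLinearCell D A)
    {f g : (Fin n → R) → WithBot (WithTop R)} (hf : IsLinearOrInfinite D f)
    (hg : IsLinearOrInfinite D g) (hfg : ∀ x ∈ A, f x < g x) {w : (Fin n → R) → R}
    (hw : IsLinear D w) (hn : ∀ x ∈ A, ¬ (f x < toExt (w x) ∧ toExt (w x) < g x)) :
    (∀ x ∈ A, toExt (w x) ≤ f x) ∨ (∀ x ∈ A, g x ≤ toExt (w x)) :=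
  not_between_aux (fun _ hu h => hu.pos_or_neg hA h) hf hg hfg hw hn

end LinearCells

/-! ### Topology of linear functions and cells -/

section Projection

variable {R : Type v} [TopologicalSpace R] {n : ℕ}

theorem continuous_proj : Continuous (proj : (Fin (n + 1) → R) → Fin n → R) :=
  continuous_pi fun i => continuous_apply i.castSucc

theorem continuous_pair {α : Type*} [TopologicalSpace α] {f : α → Fin n → R} {g : α → R}
    (hf : Continuous f) (hg : Continuous g) : Continuous fun a => pair (f a) (g a) := by
  refine continuous_pi fun i => ?_
  refine Fin.lastCases ?_ (fun i => ?_) i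
  · simpa using hg
  · simpa [pair] using continuous_pi_iff.1 hf i

theorem proj_mem_closure {B : Set (Fin n → R)} {E : Set (Fin (n + 1) → R)}
    (h : ∀ z ∈ E, proj z ∈ B) {z : Fin (n + 1) → R} (hz : z ∈ closure E) : proj z ∈ closure B :=
  map_mem_closure continuous_proj hz h

end Projection

section Topology

variable {D : Type u} {R : Type v} [DivisionRing D] [LinearOrder D] [IsStrictOrderedRing D]
  [AddCommGroup R] [LinearOrder R] [IsOrderedAddMonoid R] [Module D R]
  [IsStrictOrderedModule D R] [TopologicalSpace R] [OrderTopology R] {n : ℕ}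

theorem continuous_scalar_smul (c : D) : Continuous fun y : R => c • y := by
  rcases lt_trichotomy c 0 with hc | rfl | hc
  · have h : Continuous fun y : R => (-c) • y :=
      (OrderIso.smulRight (β := R) (neg_pos.2 hc)).continuous
    have h' : (fun y : R => c • y) = fun y => -((-c) • y) := by
      funext y; simp
    rw [h']
    exact h.neg
  · simpa using! continuous_const
  · exact (OrderIso.smulRight (β := R) hc).continuous

theorem IsLinear.continuous {f : (Fin n → R) → R} (hf : IsLinear D f) : Continuous f := by
  obtain ⟨c, a, hf⟩ := hf
  rw [show f = _ from funext hf]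
  exact (continuous_finsetSum _ fun i _ =>
    (continuous_scalar_smul (c i)).comp (continuous_apply i)).add continuous_const

theorem IsLinearOrInfinite.isClosed_le {f g : (Fin n → R) → WithBot (WithTop R)}
    (hf : IsLinearOrInfinite D f) (hg : IsLinearOrInfinite D g) : IsClosed {x | f x ≤ g x} := by
  obtain hf | hf | ⟨f₀, hfl, hf⟩ := hf
  · simp [hf]
  · obtain hg | hg | ⟨g₀, hgl, hg⟩ := hg
    · simp [hf, hg]
    · simp [hg]
    · simp [hf, hg, (toExt_lt_top _).not_ge]
  · obtain hg | hg | ⟨g₀, hgl, hg⟩ := hg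
    · simp [hf, hg, (bot_lt_toExt _).not_ge]
    · simp [hg]
    · simp only [hf, hg, toExt_le]
      exact _root_.isClosed_le hfl.continuous hgl.continuous

theorem IsLinearOrInfinite.le_of_mem_closure {f g : (Fin n → R) → WithBot (WithTop R)}
    (hf : IsLinearOrInfinite D f) (hg : IsLinearOrInfinite D g) {B : Set (Fin n → R)}
    (h : ∀ x ∈ B, f x ≤ g x) {c : Fin n → R} (hc : c ∈ closure B) : f c ≤ g c :=
  closure_minimal (s := B) h (hf.isClosed_le hg) hc

theorem IsLinearOrInfinite.eq_of_mem_closure {f g : (Fin n → R) → WithBot (WithTop R)}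
    (hf : IsLinearOrInfinite D f) (hg : IsLinearOrInfinite D g) {B : Set (Fin n → R)}
    (h : ∀ x ∈ B, f x = g x) {c : Fin n → R} (hc : c ∈ closure B) : f c = g c :=
  le_antisymm (hf.le_of_mem_closure hg (fun x hx => (h x hx).le) hc)
    (hg.le_of_mem_closure hf (fun x hx => (h x hx).ge) hc)

theorem IsLinear.eq_of_mem_closure {f g : (Fin n → R) → R}
    (hf : IsLinear D f) (hg : IsLinear D g) {B : Set (Fin n → R)}
    (h : ∀ x ∈ B, f x = g x) {c : Fin n → R} (hc : c ∈ closure B) : f c = g c :=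
  closure_minimal (s := B) h (isClosed_eq hf.continuous hg.continuous) hc

theorem mem_closure_graph {B : Set (Fin n → R)} {h : (Fin n → R) → R} (hl : IsLinear D h)
    {z : Fin (n + 1) → R} :
    z ∈ closure (graph B h) ↔ proj z ∈ closure B ∧ z (Fin.last n) = h (proj z) := by
  constructor
  · intro hz
    refine ⟨proj_mem_closure (fun z hz => hz.1) hz, ?_⟩
    exact closure_minimal (s := graph B h) (t := {z | z (Fin.last n) = h (proj z)})
      (fun z hz => hz.2) (isClosed_eq (continuous_apply _) hl.comp_proj.continuous) hz
  · rintro ⟨hz, he⟩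
    rw [← pair_proj z, he]
    exact map_mem_closure (f := fun x => pair x (h x)) (continuous_pair continuous_id hl.continuous)
      hz fun x hx => pair_mem_graph.2 ⟨hx, rfl⟩

/-- The closure of a cylinder. That the closed cylinder over `closure B` is contained in it holds
also where the two bounds meet: nearby points of `B` have a nonempty fibre that comes close to the
common value. -/
theorem mem_closure_cylinder [Nontrivial R] {B : Set (Fin n → R)}
    {f g : (Fin n → R) → WithBot (WithTop R)}
    (hf : IsLinearOrInfinite D f) (hg : IsLinearOrInfinite D g) (hfg : ∀ x ∈ B, f x < g x)
    {z : Fin (n + 1) → R} :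
    z ∈ closure (cylinder B f g) ↔
      proj z ∈ closure B ∧ f (proj z) ≤ toExt (z (Fin.last n)) ∧
        toExt (z (Fin.last n)) ≤ g (proj z) := by
  have hlast : IsLinearOrInfinite D fun z : Fin (n + 1) → R => toExt (z (Fin.last n)) :=
    (isLinear_apply _).isLinearOrInfinite
  constructor
  · intro hz
    exact ⟨proj_mem_closure (fun z hz => hz.1) hz,
      hf.comp_proj.le_of_mem_closure hlast (fun z hz => hz.2.1.le) hz,
      hlast.le_of_mem_closure hg.comp_proj (fun z hz => hz.2.2.le) hz⟩
  · rintro ⟨hz, h1, h2⟩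
    have := denselyOrdered_of_module D R
    rw [mem_closure_iff_nhds]
    intro U hU
    -- a product neighbourhood `V × (a, b)` of `z` inside `U`
    set x := proj z with hx
    set y := z (Fin.last n) with hy
    have hU' : (fun p : (Fin n → R) × R => pair p.1 p.2) ⁻¹' U ∈ nhds (x, y) := by
      refine (continuous_pair continuous_fst continuous_snd).continuousAt ?_
      simpa [hx, hy] using hU
    obtain ⟨V, hV, W, hW, hVW⟩ := mem_nhds_prod_iff.1 hU'
    obtain ⟨a, b, hy', hab⟩ := (mem_nhds_iff_exists_Ioo_subset (a := y)).1 hW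
    -- near `x` the bounds satisfy `f < b` and `a < g`
    have hfb : {x' | f x' < toExt b} ∈ nhds x := by
      have hc := (((isLinear_const (D := D) (n := n) b).isLinearOrInfinite).isClosed_le hf)
      have := hc.isOpen_compl.mem_nhds (x := x)
        (not_le.2 (h1.trans_lt (toExt_lt.2 hy'.2)))
      filter_upwards [this] with x' hx' using not_le.1 hx'
    have hga : {x' | toExt a < g x'} ∈ nhds x := by
      have hc := (hg.isClosed_le ((isLinear_const (D := D) (n := n) a).isLinearOrInfinite))
      have := hc.isOpen_compl.mem_nhds (x := x)
        (not_le.2 ((toExt_lt.2 hy'.1).trans_le h2))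
      filter_upwards [this] with x' hx' using not_le.1 hx'
    obtain ⟨x', ⟨⟨hx'V, hx'f⟩, hx'g⟩, hx'B⟩ := mem_closure_iff_nhds.1 hz _
      (Filter.inter_mem (Filter.inter_mem hV hfb) hga)
    have hlt : max (f x') (toExt a) < min (g x') (toExt b) :=
      max_lt (lt_min (hfg _ hx'B) hx'f) (lt_min hx'g (toExt_lt.2 (hy'.1.trans hy'.2)))
    obtain ⟨y', hy1, hy2⟩ := exists_toExt_between hlt
    refine ⟨pair x' y', ?_, pair_mem_cylinder.2 ⟨hx'B, (le_max_left _ _).trans_lt hy1,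
      hy2.trans_le (min_le_left _ _)⟩⟩
    exact hVW (Set.mk_mem_prod hx'V (hab ⟨toExt_lt.1 ((le_max_right _ _).trans_lt hy1),
      toExt_lt.1 (hy2.trans_le (min_le_right _ _))⟩))

end Topology

/-! ### Definability, and linear cells as cells -/

section Definable

variable {D : Type u} {R : Type v} [DivisionRing D] [AddCommGroup R] [LinearOrder R] [Module D R]
  {n : ℕ}

theorem IsLinear.definableFun {f : (Fin n → R) → R} (hf : IsLinear D f) :
    (Set.univ : Set R).DefinableFun (lang D) f := by
  obtain ⟨c, a, hf⟩ := hf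
  have hadd : ∀ {f g : (Fin n → R) → R}, (Set.univ : Set R).DefinableFun (lang D) f →
      (Set.univ : Set R).DefinableFun (lang D) g →
      (Set.univ : Set R).DefinableFun (lang D) fun x => f x + g x := by
    intro f g hf hg
    have h2 : (Set.univ : Set R).DefinableFun (lang D) (fun x : Fin 2 → R => x 0 + x 1) :=
      .of_empty (Set.DefinableFun.fun_symbol (L := lang D) (M := R) (n := 2) FunSymb.add)
    exact h2.comp (g := fun x => ![f x, g x]) (by
      intro i
      fin_cases i
      · exact hf
      · exact hg)
  have hsmul : ∀ (r : D) {f : (Fin n → R) → R}, (Set.univ : Set R).DefinableFun (lang D) f →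
      (Set.univ : Set R).DefinableFun (lang D) fun x => r • f x := by
    intro r f hf
    have h1 : (Set.univ : Set R).DefinableFun (lang D) (fun x : Fin 1 → R => r • x 0) :=
      .of_empty (Set.DefinableFun.fun_symbol (L := lang D) (M := R) (n := 1) (FunSymb.smul r))
    exact h1.comp (g := fun x => ![f x]) (by
      intro i
      fin_cases i
      exact hf)
  have hconst : ∀ b : R, (Set.univ : Set R).DefinableFun (lang D) fun _ : Fin n → R => b :=
    fun b => (lang D).definableFun_const _ (Set.mem_univ b)
  rw [show f = _ from funext hf]
  refine hadd ?_ (hconst a)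
  induction (Finset.univ : Finset (Fin n)) using Finset.induction_on with
  | empty => simpa using hconst 0
  | insert i s hi ih =>
    simp only [Finset.sum_insert hi]
    exact hadd (hsmul _ (Set.DefinableFun.proj _)) ih

theorem IsLinear.isDefinable_eq {f g : (Fin n → R) → R} (hf : IsLinear D f) (hg : IsLinear D g) :
    IsDefinable D {x | f x = g x} :=
  hf.definableFun.ofPred_eq hg.definableFun

theorem IsLinear.isDefinable_lt {f g : (Fin n → R) → R} (hf : IsLinear D f) (hg : IsLinear D g) :
    IsDefinable D {x | f x < g x} := by
  have h2 : (Set.univ : Set R).Definable (lang D) {x : Fin 2 → R | x 0 < x 1} := by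
    refine Set.Definable.mono (A := ∅) ?_ (Set.empty_subset _)
    rw [Set.empty_definable_iff]
    refine ⟨FirstOrder.Language.Relations.formula₂ (L := lang D) RelSymb.lt
      (FirstOrder.Language.Term.var 0) (FirstOrder.Language.Term.var 1), ?_⟩
    ext x
    simp
    rfl
  exact h2.preimage_map (F := fun x => ![f x, g x]) (by
    intro i
    fin_cases i
    · exact hf.definableFun
    · exact hg.definableFun)

theorem IsLinearOrInfinite.isDefinable_lt {f g : (Fin n → R) → WithBot (WithTop R)}
    (hf : IsLinearOrInfinite D f) (hg : IsLinearOrInfinite D g) :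
    IsDefinable D {x | f x < g x} := by
  have h0 : IsDefinable D (∅ : Set (Fin n → R)) := Set.definable_empty
  have h1 : IsDefinable D (Set.univ : Set (Fin n → R)) := Set.definable_univ
  obtain hf | hf | ⟨f₀, hfl, hf⟩ := hf
  · obtain hg | hg | ⟨g₀, hgl, hg⟩ := hg
    · simpa [hf, hg] using h0
    · simpa [hf, hg, ext_bot_lt_top] using h1
    · simpa [hf, hg, bot_lt_toExt] using h1
  · simpa [hf] using h0
  · obtain hg | hg | ⟨g₀, hgl, hg⟩ := hg
    · simpa [hg] using h0
    · simpa [hf, hg, toExt_lt_top] using h1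
    · simp only [hf, hg, toExt_lt]
      exact hfl.isDefinable_lt hgl

theorem IsDefinable.comp_proj {X : Set (Fin n → R)} (hX : IsDefinable D X) :
    IsDefinable D {z : Fin (n + 1) → R | proj z ∈ X} :=
  Set.Definable.preimage_comp (Fin.castSucc : Fin n → Fin (n + 1)) hX

end Definable

section DefinableCells

variable {D : Type u} {R : Type v} [DivisionRing D] [AddCommGroup R] [LinearOrder R] [Module D R]
  {n : ℕ}

theorem IsDefinable.graph {X : Set (Fin n → R)} (hX : IsDefinable D X) {f : (Fin n → R) → R}
    (hf : IsLinear D f) : IsDefinable D (graph X f) :=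
  hX.comp_proj.inter ((isLinear_apply (Fin.last n)).isDefinable_eq hf.comp_proj)

theorem IsLinearCell.isDefinable {n : ℕ} {Z : Set (Fin n → R)} (hZ : IsLinearCell D Z) :
    IsDefinable D Z := by
  induction n with
  | zero =>
    rw [show Z = Set.univ from hZ]
    exact Set.definable_univ
  | succ n ih =>
    obtain ⟨X, hX, ⟨f, hf, rfl⟩ | ⟨f, g, hf, hg, -, rfl⟩⟩ := hZ
    · exact (ih hX).graph hf
    · have hl := (isLinear_apply (D := D) (R := R) (Fin.last n)).isLinearOrInfinite
      exact (ih hX).comp_proj.inter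
        ((hf.comp_proj.isDefinable_lt hl).inter (hl.isDefinable_lt hg.comp_proj))

theorem isOpen_cylinder [IsOrderedAddMonoid R] [TopologicalSpace R] [OrderTopology R]
    {f g : (Fin n → R) → WithBot (WithTop R)} {X : Set (Fin n → R)} (hX : IsOpen X)
    (hf : IsContDefOrInfinite D X f)
    (hg : IsContDefOrInfinite D X g) : IsOpen (cylinder X f g) := by
  have hY : IsOpen {z : Fin (n + 1) → R | proj z ∈ X} := hX.preimage continuous_proj
  have hcomp : ∀ {f₀ : (Fin n → R) → R}, IsContDef D X f₀ →
      ContinuousOn (fun z : Fin (n + 1) → R => z (Fin.last n) - f₀ (proj z)) {z | proj z ∈ X} :=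
    fun hf₀ => (continuous_apply _).continuousOn.sub
      (hf₀.1.comp continuous_proj.continuousOn fun _ hz => hz)
  have h1 : IsOpen {z : Fin (n + 1) → R | proj z ∈ X ∧ f (proj z) < toExt (z (Fin.last n))} := by
    obtain hf | hf | ⟨f₀, hf₀, hf⟩ := hf
    · convert hY using 1
      ext z
      exact and_iff_left_of_imp fun hz => (hf _ hz) ▸ bot_lt_toExt _
    · convert isOpen_empty using 1
      ext z
      exact iff_of_false (fun hz => not_top_lt (hf _ hz.1 ▸ hz.2)) (Set.notMem_empty _)
    · convert (hcomp hf₀).isOpen_inter_preimage hY (isOpen_Ioi (a := 0)) using 1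
      ext z
      refine and_congr_right fun hz => ?_
      rw [hf _ hz, toExt_lt]
      exact sub_pos.symm
  have h2 : IsOpen {z : Fin (n + 1) → R | proj z ∈ X ∧ toExt (z (Fin.last n)) < g (proj z)} := by
    obtain hg | hg | ⟨g₀, hg₀, hg⟩ := hg
    · convert isOpen_empty using 1
      ext z
      exact iff_of_false (fun hz => not_lt_bot (hg _ hz.1 ▸ hz.2)) (Set.notMem_empty _)
    · convert hY using 1
      ext z
      exact and_iff_left_of_imp fun hz => (hg _ hz) ▸ toExt_lt_top _
    · convert (hcomp hg₀).isOpen_inter_preimage hY (isOpen_Iio (a := 0)) using 1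
      ext z
      refine and_congr_right fun hz => ?_
      rw [hg _ hz, toExt_lt]
      exact sub_neg.symm
  convert h1.inter h2 using 1
  ext z
  exact ⟨fun h => ⟨⟨h.1, h.2.1⟩, h.1, h.2.2⟩, fun h => ⟨h.1.1, h.1.2, h.2.2⟩⟩

variable [LinearOrder D] [IsStrictOrderedRing D] [IsOrderedAddMonoid R]
  [IsStrictOrderedModule D R] [TopologicalSpace R] [OrderTopology R]

theorem IsLinear.isContDef {X : Set (Fin n → R)} (hX : IsLinearCell D X) {f : (Fin n → R) → R}
    (hf : IsLinear D f) : IsContDef D X f :=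
  ⟨hf.continuous.continuousOn, hX.isDefinable.graph hf⟩

theorem IsLinearOrInfinite.isContDefOrInfinite {X : Set (Fin n → R)} (hX : IsLinearCell D X)
    {f : (Fin n → R) → WithBot (WithTop R)} (hf : IsLinearOrInfinite D f) :
    IsContDefOrInfinite D X f := by
  obtain hf | hf | ⟨f₀, hl, hf⟩ := hf
  · exact Or.inl fun x _ => hf x
  · exact Or.inr (Or.inl fun x _ => hf x)
  · exact Or.inr (Or.inr ⟨f₀, hl.isContDef hX, fun x _ => hf x⟩)

theorem IsLinearCell.isCell {n : ℕ} {Z : Set (Fin n → R)} (hZ : IsLinearCell D Z) :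
    IsCell D Z := by
  induction n with
  | zero => exact hZ
  | succ n ih =>
    obtain ⟨X, hX, ⟨f, hf, rfl⟩ | ⟨f, g, hf, hg, h, rfl⟩⟩ := hZ
    · exact ⟨X, ih hX, Or.inl ⟨f, hf.isContDef hX, rfl⟩⟩
    · exact ⟨X, ih hX, Or.inr ⟨f, g, hf.isContDefOrInfinite hX, hg.isContDefOrInfinite hX, h, rfl⟩⟩

end DefinableCells

/-! ### Sign conditions and quantifier elimination -/

section SameSign

/-- The elements `a` and `b` are both positive, both zero or both negative. -/
def SameSign {R : Type v} [Zero R] [LT R] (a b : R) : Prop := (0 < a ↔ 0 < b) ∧ (a < 0 ↔ b < 0)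

variable {D : Type u} {R : Type v} [AddCommGroup R] [LinearOrder R]

theorem SameSign.refl (a : R) : SameSign a a := ⟨Iff.rfl, Iff.rfl⟩

theorem SameSign.symm {a b : R} (h : SameSign a b) : SameSign b a := ⟨h.1.symm, h.2.symm⟩

theorem SameSign.of_pos {a b : R} (ha : 0 < a) (hb : 0 < b) : SameSign a b :=
  ⟨iff_of_true ha hb, iff_of_false ha.not_gt hb.not_gt⟩

theorem SameSign.of_neg {a b : R} (ha : a < 0) (hb : b < 0) : SameSign a b :=
  ⟨iff_of_false ha.not_gt hb.not_gt, iff_of_true ha hb⟩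

theorem SameSign.eq_zero_iff {a b : R} (h : SameSign a b) : a = 0 ↔ b = 0 := by
  have e : ∀ c : R, c = 0 ↔ ¬ 0 < c ∧ ¬ c < 0 := fun c =>
    ⟨fun hc => by simp [hc], fun hc => le_antisymm (not_lt.1 hc.1) (not_lt.1 hc.2)⟩
  rw [e, e, h.1, h.2]

theorem SameSign.neg [IsOrderedAddMonoid R] {a b : R} (h : SameSign a b) : SameSign (-a) (-b) :=
  ⟨by simpa using h.2, by simpa using h.1⟩

theorem SameSign.smul [DivisionRing D] [LinearOrder D] [IsStrictOrderedRing D]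
    [IsOrderedAddMonoid R] [Module D R] [IsStrictOrderedModule D R]
    {a b : R} (h : SameSign a b) (c : D) : SameSign (c • a) (c • b) := by
  have key : ∀ {c : D}, 0 < c → SameSign (c • a) (c • b) := fun {c} hc =>
    ⟨by rw [smul_pos_iff_of_pos_left hc, smul_pos_iff_of_pos_left hc, h.1],
      by rw [smul_neg_iff_of_pos_left hc, smul_neg_iff_of_pos_left hc, h.2]⟩
  rcases lt_trichotomy c 0 with hc | rfl | hc
  · simpa using (key (neg_pos.2 hc)).neg
  · simpa using SameSign.refl (0 : R)
  · exact key hc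

end SameSign

section SignDetermined

variable {D : Type u} {R : Type v} [DivisionRing D] [AddCommGroup R] [LinearOrder R] [Module D R]
  {n : ℕ}

/-- Membership in `X` depends only on the signs of finitely many linear functions. -/
def IsSignDetermined (D : Type u) [DivisionRing D] [Module D R] (X : Set (Fin n → R)) : Prop :=
  ∃ F : Set ((Fin n → R) → R), F.Finite ∧ (∀ f ∈ F, IsLinear D f) ∧
    ∀ x y, (∀ f ∈ F, SameSign (f x) (f y)) → x ∈ X → y ∈ X

theorem IsSignDetermined.compl {X : Set (Fin n → R)} (hX : IsSignDetermined D X) :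
    IsSignDetermined D Xᶜ := by
  obtain ⟨F, hF, hl, h⟩ := hX
  exact ⟨F, hF, hl, fun x y hxy hx hy => hx (h y x (fun f hf => (hxy f hf).symm) hy)⟩

theorem IsSignDetermined.union {X Y : Set (Fin n → R)} (hX : IsSignDetermined D X)
    (hY : IsSignDetermined D Y) : IsSignDetermined D (X ∪ Y) := by
  obtain ⟨F, hF, hl, h⟩ := hX
  obtain ⟨G, hG, hm, k⟩ := hY
  refine ⟨F ∪ G, hF.union hG, fun f hf => hf.elim (hl f) (hm f), fun x y hxy => Or.imp ?_ ?_⟩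
  · exact h x y fun f hf => hxy f (Or.inl hf)
  · exact k x y fun f hf => hxy f (Or.inr hf)

theorem isSignDetermined_of_isLinear {f : (Fin n → R) → R} (hf : IsLinear D f)
    {X : Set (Fin n → R)} (h : ∀ x y, SameSign (f x) (f y) → x ∈ X → y ∈ X) :
    IsSignDetermined D X :=
  ⟨{f}, Set.finite_singleton f, by rintro _ rfl; exact hf, fun x y hxy => h x y (hxy f rfl)⟩

/-- Terms of the language of ordered vector spaces with parameters are linear functions. -/
theorem isLinear_realize {α : Type*} (t : ((lang D).withConstants (Set.univ : Set R)).Term α)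
    (v : (Fin n → R) → α → R) (hv : ∀ a, IsLinear D fun x => v x a) :
    IsLinear D fun x => t.realize (v x) := by
  induction t with
  | var a => exact hv a
  | @func l f ts ih =>
    rcases f with f | f
    · cases f with
      | zero => exact isLinear_const 0
      | add => exact (ih 0).add (ih 1)
      | smul c => exact (ih 0).smul c
    · match l, f with
      | 0, f => exact isLinear_const (f : (Set.univ : Set R)).1

end SignDetermined

section Elimination

variable {D : Type u} {R : Type v} [DivisionRing D] [LinearOrder D] [IsStrictOrderedRing D]
  [AddCommGroup R] [LinearOrder R] [IsOrderedAddMonoid R] [Module D R]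
  [IsStrictOrderedModule D R] {n : ℕ}

/-- The signs of finitely many linear functions at a point `z` of `R ^ (n + 1)` are determined by
the signs of finitely many linear functions at `proj z` and by the position of the last coordinate
with respect to finitely many linear functions of `proj z`. -/
theorem exists_walls {F : Set ((Fin (n + 1) → R) → R)} (hF : F.Finite)
    (hl : ∀ f ∈ F, IsLinear D f) :
    ∃ G H : Set ((Fin n → R) → R), G.Finite ∧ H.Finite ∧ (∀ g ∈ G, IsLinear D g) ∧
      (∀ h ∈ H, IsLinear D h) ∧ ∀ z w : Fin (n + 1) → R,
        (∀ g ∈ G, SameSign (g (proj z)) (g (proj w))) →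
        (∀ h ∈ H, SameSign (z (Fin.last n) - h (proj z)) (w (Fin.last n) - h (proj w))) →
        ∀ f ∈ F, SameSign (f z) (f w) := by
  choose! f₀ c hl₀ hs using fun f hf => (hl f hf).exists_split
  refine ⟨f₀ '' F, (fun f x => (-(c f)⁻¹) • f₀ f x) '' F, hF.image _, hF.image _, ?_, ?_, ?_⟩
  · rintro _ ⟨f, hf, rfl⟩
    exact hl₀ f hf
  · rintro _ ⟨f, hf, rfl⟩
    exact (hl₀ f hf).smul _
  · intro z w hG hH f hf
    rcases eq_or_ne (c f) 0 with hc | hc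
    · have := hG _ ⟨f, hf, rfl⟩
      simpa [hs f hf, hc] using this
    · have e : ∀ z, f z = c f • (z (Fin.last n) - (-(c f)⁻¹) • f₀ f (proj z)) := fun z => by
        rw [hs f hf, smul_sub, smul_smul, mul_neg, mul_inv_cancel₀ hc, neg_one_smul]
        abel
      rw [e z, e w]
      exact (hH _ ⟨f, hf, rfl⟩).smul _

/-- The differences of the members of `H`. -/
def differences {n : ℕ} {R : Type v} [AddCommGroup R] (H : Set ((Fin n → R) → R)) :
    Set ((Fin n → R) → R) :=
  Set.image2 (fun h h' x => h x - h' x) H H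

/-- Elimination of an existential quantifier: if the linear functions through which the last
coordinate is restricted are ordered over `x'` as over `x`, then for every `y` there is a `y'`
in the same position over `x'` as `y` over `x`. -/
theorem IsSignDetermined.exists [Nontrivial R] {X : Set (Fin (n + 1) → R)}
    (hX : IsSignDetermined D X) : IsSignDetermined D {x | ∃ y, pair x y ∈ X} := by
  have := denselyOrdered_of_module D R
  obtain ⟨F, hF, hl, hX⟩ := hX
  obtain ⟨G, H, hG, hH, hGl, hHl, hGH⟩ := exists_walls hF hl
  refine ⟨G ∪ differences H, hG.union (hH.image2 _ hH), ?_, ?_⟩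
  · rintro f (hf | ⟨h, hh, h', hh', rfl⟩)
    · exact hGl f hf
    · exact (hHl h hh).sub (hHl h' hh')
  · rintro x x' hxx ⟨y, hy⟩
    have hd : ∀ h ∈ H, ∀ h' ∈ H, SameSign (h x - h' x) (h x' - h' x') := fun h hh h' hh' =>
      hxx _ (Or.inr ⟨h, hh, h', hh', rfl⟩)
    suffices ∃ y', ∀ h ∈ H, SameSign (y - h x) (y' - h x') by
      obtain ⟨y', hy'⟩ := this
      refine ⟨y', hX _ _ (hGH _ _ ?_ ?_) hy⟩
      · intro g hg
        simpa using hxx g (Or.inl hg)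
      · simpa using hy'
    by_cases hyH : ∃ h ∈ H, y = h x
    · obtain ⟨h, hh, rfl⟩ := hyH
      exact ⟨h x', hd h hh⟩
    · push Not at hyH
      have hlo : ((fun h : (Fin n → R) → R => h x') '' {h ∈ H | h x < y}).Finite :=
        (hH.subset (Set.sep_subset _ _)).image _
      have hhi : ((fun h : (Fin n → R) → R => h x') '' {h ∈ H | y < h x}).Finite :=
        (hH.subset (Set.sep_subset _ _)).image _
      obtain ⟨y', h1, h2⟩ := Order.exists_between_finsets (lo := hlo.toFinset)
        (hi := hhi.toFinset) (by
          simp only [Set.Finite.mem_toFinset]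
          rintro _ ⟨h, ⟨hh, hl⟩, rfl⟩ _ ⟨h', ⟨hh', hl'⟩, rfl⟩
          exact sub_neg.1 ((hd h hh h' hh').2.1 (sub_neg.2 (hl.trans hl'))))
      simp only [Set.Finite.mem_toFinset] at h1 h2
      refine ⟨y', fun h hh => ?_⟩
      rcases lt_or_gt_of_ne (hyH h hh) with hlt | hlt
      · have := h2 _ ⟨h, ⟨hh, hlt⟩, rfl⟩
        exact SameSign.of_neg (sub_neg.2 hlt) (sub_neg.2 this)
      · have := h1 _ ⟨h, ⟨hh, hlt⟩, rfl⟩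
        exact SameSign.of_pos (sub_pos.2 hlt) (sub_pos.2 this)

/-- Quantifier elimination. -/
theorem isSignDetermined_boundedFormula [Nontrivial R] {k : ℕ}
    (φ : ((lang D).withConstants (Set.univ : Set R)).BoundedFormula (Fin n) k) :
    IsSignDetermined D {z : Fin (n + k) → R |
      φ.Realize (fun i => z (Fin.castAdd k i)) (fun j => z (Fin.natAdd n j))} := by
  have hv : ∀ k : ℕ, ∀ a : Fin n ⊕ Fin k, IsLinear D fun z : Fin (n + k) → R =>
      (Sum.elim (fun i => z (Fin.castAdd k i)) (fun j => z (Fin.natAdd n j)) : _ → R) a := by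
    rintro k (i | j)
    · exact isLinear_apply _
    · exact isLinear_apply _
  induction φ with
  | falsum => exact ⟨∅, Set.finite_empty, by simp, fun _ _ _ h => h⟩
  | @equal k t₁ t₂ =>
    exact isSignDetermined_of_isLinear
      ((isLinear_realize t₁ _ (hv k)).sub (isLinear_realize t₂ _ (hv k)))
      fun x y hxy hx => sub_eq_zero.1 (hxy.eq_zero_iff.1 (sub_eq_zero.2 hx))
  | @rel k l r ts =>
    rcases r with r | r
    · cases r with
      | lt =>
        exact isSignDetermined_of_isLinear
          ((isLinear_realize (ts 0) _ (hv k)).sub (isLinear_realize (ts 1) _ (hv k)))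
          fun x y hxy hx => sub_neg.1 (hxy.2.1 (sub_neg.2 hx))
    · exact (r : Empty).elim
  | imp φ ψ ihφ ihψ =>
    convert ihφ.compl.union ihψ using 1
    ext z
    simp [imp_iff_not_or]
  | @all k φ ih =>
    convert (IsSignDetermined.exists (n := n + k) ih.compl).compl using 1
    ext z
    have h : ∀ y, (fun j : Fin (k + 1) => pair z y (Fin.natAdd n j)) =
        Fin.snoc (α := fun _ => R) (fun j => z (Fin.natAdd n j)) y := by
      intro y
      funext j
      refine Fin.lastCases ?_ (fun j => ?_) j
      · rw [Fin.snoc_last]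
        exact pair_last z y
      · rw [Fin.snoc_castSucc]
        exact congrFun (proj_pair z y) (Fin.natAdd n j)
    have h' : ∀ y, (fun i : Fin n => pair z y (Fin.castAdd (k + 1) i)) =
        fun i => z (Fin.castAdd k i) := fun y =>
      funext fun i => congrFun (proj_pair z y) (Fin.castAdd k i)
    change (∀ y, φ.Realize (fun i => z (Fin.castAdd k i))
      (Fin.snoc (α := fun _ => R) (fun j => z (Fin.natAdd n j)) y)) ↔
      ¬ ∃ y, ¬ φ.Realize (fun i => pair z y (Fin.castAdd (k + 1) i))
        (fun j => pair z y (Fin.natAdd n j))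
    simp only [h, h', not_exists, not_not]

theorem IsDefinable.isSignDetermined [Nontrivial R] {X : Set (Fin n → R)} (hX : IsDefinable D X) :
    IsSignDetermined D X := by
  obtain ⟨φ, rfl⟩ := hX
  obtain ⟨F, hF, hl, h⟩ := isSignDetermined_boundedFormula φ
  have hr : ∀ x : Fin n → R, φ.Realize x ↔ FirstOrder.Language.BoundedFormula.Realize φ
      (fun i => x (Fin.castAdd 0 i)) (fun j : Fin 0 => x (Fin.natAdd n j)) := fun x =>
    iff_of_eq (congrArg (FirstOrder.Language.BoundedFormula.Realize φ x) (Subsingleton.elim _ _))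
  exact ⟨F, hF, hl, fun x y hxy hx => (hr y).2 (h x y hxy ((hr x).1 hx))⟩

end Elimination

/-! ### Existence of special linear decompositions -/

section Decompositions

variable {D : Type u} {R : Type v} [DivisionRing D] [AddCommGroup R] [LinearOrder R] [Module D R]
  [TopologicalSpace R] {n : ℕ}

theorem IsDecomposition.finite {C : Set (Set (Fin n → R))} (hC : IsDecomposition D C) :
    C.Finite := by
  cases n with
  | zero => rw [show C = {Set.univ} from hC]; exact Set.finite_singleton _
  | succ n => exact hC.1

theorem IsDecomposition.pairwiseDisjoint {C : Set (Set (Fin n → R))} (hC : IsDecomposition D C) :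
    C.PairwiseDisjoint id := by
  cases n with
  | zero => rw [show C = {Set.univ} from hC]; exact Set.pairwiseDisjoint_singleton _ _
  | succ n => exact hC.2.1

theorem IsDecomposition.sUnion_eq {C : Set (Set (Fin n → R))} (hC : IsDecomposition D C) :
    ⋃₀ C = Set.univ := by
  cases n with
  | zero => rw [show C = {Set.univ} from hC]; exact Set.sUnion_singleton _
  | succ n => exact hC.2.2.1

theorem IsDecomposition.eq_of_mem {C : Set (Set (Fin n → R))} (hC : IsDecomposition D C)
    {A B : Set (Fin n → R)} (hA : A ∈ C) (hB : B ∈ C) {x : Fin n → R} (hxA : x ∈ A)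
    (hxB : x ∈ B) : A = B :=
  hC.pairwiseDisjoint.elim_set hA hB x hxA hxB

theorem IsDecomposition.exists_mem {C : Set (Set (Fin n → R))} (hC : IsDecomposition D C)
    (x : Fin n → R) : ∃ B ∈ C, x ∈ B := by
  have : x ∈ ⋃₀ C := hC.sUnion_eq ▸ Set.mem_univ x
  exact this

theorem IsSpecial.isLinearDecomposition {C : Set (Set (Fin n → R))} (hC : IsSpecial D C) :
    IsLinearDecomposition D C := by
  match n with
  | 0 => exact hC
  | 1 => exact hC
  | n + 2 => exact hC.1

theorem IsSpecial.isDecomposition {C : Set (Set (Fin n → R))} (hC : IsSpecial D C) :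
    IsDecomposition D C :=
  hC.isLinearDecomposition.1

theorem IsSpecial.isLinearCell {C : Set (Set (Fin n → R))} (hC : IsSpecial D C)
    {B : Set (Fin n → R)} (hB : B ∈ C) : IsLinearCell D B :=
  hC.isLinearDecomposition.2 B hB

/-- The condition on the closures of the cells of a special decomposition of `R ^ (n + 1)`. -/
def NoCrossing (D : Type u) [DivisionRing D] [Module D R]
    (C : Set (Set (Fin (n + 1) → R))) : Prop :=
  ∀ A B h f g, IsLinear D h → IsLinearOrInfinite D f → IsLinearOrInfinite D g →
    (∀ x ∈ B, f x < g x) → graph A h ∈ C → cylinder B f g ∈ C →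
      ¬ ∃ c ∈ closure A ∩ closure B, f c < toExt (h c) ∧ toExt (h c) < g c

theorem IsSpecial.of_succ {C : Set (Set (Fin (n + 1) → R))} (h : IsLinearDecomposition D C)
    (h' : IsSpecial D (projAll C)) (h'' : NoCrossing D C) : IsSpecial D C := by
  cases n with
  | zero => exact h
  | succ n => exact ⟨h, h', h''⟩

end Decompositions

section Bounds

variable {R : Type v} {n : ℕ}

/-- The members of `H` and the constants `±∞`, as functions with values in `R ∪ {±∞}`. -/
def bounds (H : Set ((Fin n → R) → R)) :
    Set ((Fin n → R) → WithBot (WithTop R)) :=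
  {fun _ => ⊥, fun _ => ⊤} ∪ (fun h x => toExt (h x)) '' H

/-- The stackOver over the members of `C` whose walls are the graphs of the members of `H`: they
consist of these graphs and of the cylinders between consecutive bounds. -/
def stackOver [LinearOrder R] (C : Set (Set (Fin n → R)))
    (H : Set ((Fin n → R) → R)) : Set (Set (Fin (n + 1) → R)) :=
  {Z | (∃ B ∈ C, ∃ h ∈ H, Z = graph B h) ∨
    ∃ B ∈ C, ∃ f ∈ bounds H, ∃ g ∈ bounds H, (∀ x ∈ B, f x < g x) ∧
      (∀ h ∈ H, ∀ x ∈ B, ¬ (f x < toExt (h x) ∧ toExt (h x) < g x)) ∧ Z = cylinder B f g}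

/-- No two members of `H` change their order over a member of `C`. -/
def OrderedOver [AddCommGroup R] [LinearOrder R] (C : Set (Set (Fin n → R)))
    (H : Set ((Fin n → R) → R)) : Prop :=
  ∀ B ∈ C, ∀ f ∈ differences H, ∀ x ∈ B, ∀ y ∈ B, SameSign (f x) (f y)

theorem toExt_mem_bounds {H : Set ((Fin n → R) → R)} {h : (Fin n → R) → R} (hh : h ∈ H) :
    (fun x => toExt (h x)) ∈ bounds H :=
  Or.inr ⟨h, hh, rfl⟩

theorem finite_bounds {H : Set ((Fin n → R) → R)} (hH : H.Finite) : (bounds H).Finite :=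
  (Set.toFinite _).union (hH.image _)

theorem finite_stackOver [LinearOrder R] {C : Set (Set (Fin n → R))} (hC : C.Finite)
    {H : Set ((Fin n → R) → R)} (hH : H.Finite) : (stackOver C H).Finite := by
  have hb := finite_bounds hH
  refine ((hC.image2 graph hH).union
    ((hC.prod (hb.prod hb)).image fun p => cylinder p.1 p.2.1 p.2.2)).subset ?_
  rintro _ (⟨B, hB, h, hh, rfl⟩ | ⟨B, hB, f, hf, g, hg, -, -, rfl⟩)
  · exact Or.inl ⟨B, hB, h, hh, rfl⟩
  · exact Or.inr ⟨(B, f, g), ⟨hB, hf, hg⟩, rfl⟩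

theorem isLinearOrInfinite_of_mem_bounds [AddCommGroup R] {D : Type u} [DivisionRing D] [Module D R]
    {H : Set ((Fin n → R) → R)} (hH : ∀ h ∈ H, IsLinear D h)
    {f : (Fin n → R) → WithBot (WithTop R)} (hf : f ∈ bounds H) : IsLinearOrInfinite D f := by
  rcases hf with (rfl | rfl) | ⟨h, hh, rfl⟩
  · exact isLinearOrInfinite_bot
  · exact isLinearOrInfinite_top
  · exact (hH h hh).isLinearOrInfinite

theorem isLinearCell_of_mem_stackOver [AddCommGroup R] [LinearOrder R] {D : Type u}
    [DivisionRing D] [Module D R] {C : Set (Set (Fin n → R))} {H : Set ((Fin n → R) → R)}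
    (hC : ∀ B ∈ C, IsLinearCell D B) (hH : ∀ h ∈ H, IsLinear D h) {Z : Set (Fin (n + 1) → R)}
    (hZ : Z ∈ stackOver C H) : IsLinearCell D Z := by
  rcases hZ with ⟨B, hB, h, hh, rfl⟩ | ⟨B, hB, f, hf, g, hg, hfg, -, rfl⟩
  · exact ⟨B, hC B hB, Or.inl ⟨h, hH h hh, rfl⟩⟩
  · exact ⟨B, hC B hB, Or.inr ⟨f, g, isLinearOrInfinite_of_mem_bounds hH hf,
      isLinearOrInfinite_of_mem_bounds hH hg, hfg, rfl⟩⟩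

variable [AddCommGroup R] [LinearOrder R] [IsOrderedAddMonoid R]

theorem OrderedOver.lt {C : Set (Set (Fin n → R))} {H : Set ((Fin n → R) → R)}
    (hCH : OrderedOver C H) {B : Set (Fin n → R)} (hB : B ∈ C)
    {f g : (Fin n → R) → WithBot (WithTop R)} (hf : f ∈ bounds H) (hg : g ∈ bounds H)
    {x y : Fin n → R} (hx : x ∈ B) (hy : y ∈ B) (h : f x < g x) : f y < g y := by
  rcases hf with (rfl | rfl) | ⟨f, hf, rfl⟩
  · rcases hg with (rfl | rfl) | ⟨g, hg, rfl⟩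
    · exact h
    · exact h
    · exact bot_lt_toExt _
  · exact absurd h not_top_lt
  · rcases hg with (rfl | rfl) | ⟨g, hg, rfl⟩
    · exact absurd h not_lt_bot
    · exact toExt_lt_top _
    · exact toExt_lt.2 (sub_neg.1 ((hCH B hB _ ⟨f, hf, g, hg, rfl⟩ x hx y hy).2.1
        (sub_neg.2 (toExt_lt.1 h))))

theorem OrderedOver.eq {C : Set (Set (Fin n → R))} {H : Set ((Fin n → R) → R)}
    (hCH : OrderedOver C H) {B : Set (Fin n → R)} (hB : B ∈ C)
    {f g : (Fin n → R) → WithBot (WithTop R)} (hf : f ∈ bounds H) (hg : g ∈ bounds H)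
    {x : Fin n → R} (hx : x ∈ B) (h : f x = g x) : ∀ y ∈ B, f y = g y := fun y hy => by
  rcases lt_trichotomy (f y) (g y) with h' | h' | h'
  · exact absurd h (hCH.lt hB hf hg hy hx h').ne
  · exact h'
  · exact absurd h (hCH.lt hB hg hf hy hx h').ne'

theorem pairwiseDisjoint_stackOver {C : Set (Set (Fin n → R))} (hC : C.PairwiseDisjoint id)
    {H : Set ((Fin n → R) → R)} (hCH : OrderedOver C H) :
    (stackOver C H).PairwiseDisjoint id := by
  intro Z hZ W hW hne
  refine Set.disjoint_left.2 fun z hzZ hzW => hne ?_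
  rcases hZ with ⟨B, hB, h, hh, rfl⟩ | ⟨B, hB, f, hf, g, hg, hfg, hn, rfl⟩ <;>
  rcases hW with ⟨B', hB', h', hh', rfl⟩ | ⟨B', hB', f', hf', g', hg', hfg', hn', rfl⟩ <;>
  obtain rfl : B = B' := hC.elim_set hB hB' _ hzZ.1 hzW.1
  · have e : toExt (h (proj z)) = toExt (h' (proj z)) := by
      rw [toExt_inj, ← hzZ.2, ← hzW.2]
    exact graph_eq_graph_iff.2 fun x hx => toExt_inj.1
      (hCH.eq hB (toExt_mem_bounds hh) (toExt_mem_bounds hh') hzZ.1 e x hx)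
  · exact absurd (hzZ.2 ▸ hzW.2) (hn' h hh _ hzZ.1)
  · exact absurd (hzW.2 ▸ hzZ.2) (hn h' hh' _ hzZ.1)
  · have key : ∀ {f g f' g' : (Fin n → R) → WithBot (WithTop R)}, f' ∈ bounds H →
        g' ∈ bounds H → (∀ h ∈ H, ∀ x ∈ B, ¬ (f x < toExt (h x) ∧ toExt (h x) < g x)) →
        z ∈ cylinder B f g → z ∈ cylinder B f' g' →
        f' (proj z) ≤ f (proj z) ∧ g (proj z) ≤ g' (proj z) := by
      intro f g f' g' hf' hg' hn hz hz'
      constructor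
      · by_contra! hlt
        rcases hf' with (rfl | rfl) | ⟨k, hk, rfl⟩
        · exact not_lt_bot hlt
        · exact not_top_lt hz'.2.1
        · exact hn k hk _ hz.1 ⟨hlt, hz'.2.1.trans hz.2.2⟩
      · by_contra! hlt
        rcases hg' with (rfl | rfl) | ⟨k, hk, rfl⟩
        · exact not_lt_bot hz'.2.2
        · exact not_top_lt hlt
        · exact hn k hk _ hz.1 ⟨hz.2.1.trans hz'.2.2, hlt⟩
    have h1 := key hf' hg' hn hzZ hzW
    have h2 := key hf hg hn' hzW hzZ
    exact cylinder_congr (hCH.eq hB hf hf' hzZ.1 (le_antisymm h2.1 h1.1))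
      (hCH.eq hB hg hg' hzZ.1 (le_antisymm h1.2 h2.2))

end Bounds

section Arrangement

variable {D : Type u} {R : Type v} [DivisionRing D] [LinearOrder D] [IsStrictOrderedRing D]
  [AddCommGroup R] [LinearOrder R] [IsOrderedAddMonoid R] [Nontrivial R] [Module D R]
  [IsStrictOrderedModule D R] {n : ℕ}

/-- A point over `B` that is on none of the graphs lies between the largest bound below it and the
least bound above it. -/
theorem exists_mem_stackOver (D : Type u) [DivisionRing D] [LinearOrder D] [IsStrictOrderedRing D]
    [Module D R] [IsStrictOrderedModule D R] {C : Set (Set (Fin n → R))} {H : Set ((Fin n → R) → R)}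
    (hH : H.Finite) (hCH : OrderedOver C H) {B : Set (Fin n → R)} (hB : B ∈ C)
    {z : Fin (n + 1) → R} (hz : proj z ∈ B) : ∃ Z ∈ stackOver C H, z ∈ Z ∧ proj '' Z = B := by
  by_cases h : ∃ h ∈ H, z (Fin.last n) = h (proj z)
  · obtain ⟨h, hh, e⟩ := h
    exact ⟨_, Or.inl ⟨B, hB, h, hh, rfl⟩, ⟨hz, e⟩, proj_image_graph _ _⟩
  · push Not at h
    set y := toExt (z (Fin.last n)) with hy
    have hb := finite_bounds hH
    obtain ⟨f, ⟨hf, hfz⟩, hfmax⟩ := Set.exists_max_image {f ∈ bounds H | f (proj z) < y}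
      (fun f => f (proj z)) (hb.subset (Set.sep_subset _ _))
      ⟨fun _ => ⊥, Or.inl (Or.inl rfl), bot_lt_toExt _⟩
    obtain ⟨g, ⟨hg, hgz⟩, hgmin⟩ := Set.exists_min_image {f ∈ bounds H | y < f (proj z)}
      (fun f => f (proj z)) (hb.subset (Set.sep_subset _ _))
      ⟨fun _ => ⊤, Or.inl (Or.inr rfl), toExt_lt_top _⟩
    have hfg : ∀ x ∈ B, f x < g x := fun x hx => hCH.lt hB hf hg hz hx (hfz.trans hgz)
    refine ⟨cylinder B f g, Or.inr ⟨B, hB, f, hf, g, hg, hfg, ?_, rfl⟩, ⟨hz, hfz, hgz⟩,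
      proj_image_cylinder D hfg⟩
    · rintro k hk x hx ⟨h1, h2⟩
      have hk' := toExt_mem_bounds hk
      have h1' := hCH.lt hB hf hk' hx hz h1
      have h2' := hCH.lt hB hk' hg hx hz h2
      rcases lt_or_gt_of_ne (h k hk) with hlt | hlt
      · exact (hgmin _ ⟨hk', toExt_lt.2 hlt⟩).not_gt h2'
      · exact (hfmax _ ⟨hk', toExt_lt.2 hlt⟩).not_gt h1'

theorem sameSign_of_mem_stackOver {C : Set (Set (Fin n → R))} {H : Set ((Fin n → R) → R)}
    (hC : ∀ B ∈ C, IsLinearCell D B) (hH : ∀ h ∈ H, IsLinear D h)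
    (hCH : OrderedOver C H) {Z : Set (Fin (n + 1) → R)} (hZ : Z ∈ stackOver C H)
    {z w : Fin (n + 1) → R} (hz : z ∈ Z) (hw : w ∈ Z) {h : (Fin n → R) → R} (hh : h ∈ H) :
    SameSign (z (Fin.last n) - h (proj z)) (w (Fin.last n) - h (proj w)) := by
  rcases hZ with ⟨B, hB, k, hk, rfl⟩ | ⟨B, hB, f, hf, g, hg, hfg, hn, rfl⟩
  · rw [hz.2, hw.2]
    exact hCH B hB _ ⟨k, hk, h, hh, rfl⟩ _ hz.1 _ hw.1
  · rcases (hH h hh).le_or_le_of_not_between (hC B hB) (isLinearOrInfinite_of_mem_bounds hH hf)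
      (isLinearOrInfinite_of_mem_bounds hH hg) hfg (hn h hh) with hle | hle
    · exact SameSign.of_pos (sub_pos.2 (toExt_lt.1 ((hle _ hz.1).trans_lt hz.2.1)))
        (sub_pos.2 (toExt_lt.1 ((hle _ hw.1).trans_lt hw.2.1)))
    · exact SameSign.of_neg (sub_neg.2 (toExt_lt.1 (hz.2.2.trans_le (hle _ hz.1))))
        (sub_neg.2 (toExt_lt.1 (hw.2.2.trans_le (hle _ hw.1))))

theorem projAll_stackOver {C : Set (Set (Fin n → R))} {H : Set ((Fin n → R) → R)}
    (hC : ∀ B ∈ C, IsLinearCell D B) (hfin : H.Finite) (hCH : OrderedOver C H) :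
    projAll (stackOver C H) = C := by
  have hp : ∀ Z ∈ stackOver C H, proj '' Z ∈ C := by
    rintro _ (⟨B, hB, h, hh, rfl⟩ | ⟨B, hB, f, hf, g, hg, hfg, -, rfl⟩)
    · rwa [proj_image_graph]
    · rwa [proj_image_cylinder D hfg]
  ext B
  constructor
  · rintro ⟨Z, hZ, rfl⟩
    exact hp Z hZ
  · intro hB
    obtain ⟨x, hx⟩ := (hC B hB).nonempty
    obtain ⟨Z, hZ, -, hZB⟩ := exists_mem_stackOver D (z := pair x 0) hfin hCH hB (by simpa using hx)
    exact ⟨Z, hZ, hZB⟩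

variable [TopologicalSpace R] [OrderTopology R]

/-- A bound of `H` that lies strictly between two others at a limit point of `B` does so at points
of `B`. -/
theorem noCrossing_stackOver {C : Set (Set (Fin n → R))} {H : Set ((Fin n → R) → R)}
    (hC : ∀ B ∈ C, IsLinearCell D B) (hH : ∀ h ∈ H, IsLinear D h) :
    NoCrossing D (stackOver C H) := by
  have := denselyOrdered_of_module D R
  rintro A B h f g hh hf hg hfg (⟨A', hA', h', hh', eA⟩ | ⟨A', hA', f₁, hf₁, g₁, hg₁, hfg₁, -, eA⟩)
    (⟨B', hB', k, hk, eB⟩ | ⟨B', hB', f', hf', g', hg', hfg', hn, eB⟩) ⟨c, ⟨hcA, hcB⟩, h1, h2⟩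
  · refine graph_ne_cylinder D ?_ hfg eB.symm
    exact closure_nonempty_iff.1 ⟨c, hcB⟩
  · obtain rfl : A = A' := by rw [← proj_image_graph A h, eA, proj_image_graph]
    obtain rfl : B = B' := by
      rw [← proj_image_cylinder D hfg, eB, proj_image_cylinder D hfg']
    have e1 : h c = h' c := hh.eq_of_mem_closure (hH h' hh') (graph_eq_graph_iff.1 eA) hcA
    have e2 : ∀ x ∈ B, f x = f' x ∧ g x = g' x := fun x hx => by
      refine ext_endpoints_eq (hfg x hx) fun y => ?_
      have := Set.ext_iff.1 eB (pair x y)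
      simpa [pair_mem_cylinder, hx] using this
    have hfl' := isLinearOrInfinite_of_mem_bounds hH hf'
    have hgl' := isLinearOrInfinite_of_mem_bounds hH hg'
    rw [e1, hf.eq_of_mem_closure hfl' (fun x hx => (e2 x hx).1) hcB] at h1
    rw [e1, hg.eq_of_mem_closure hgl' (fun x hx => (e2 x hx).2) hcB] at h2
    have hl := (hH h' hh').isLinearOrInfinite
    have ho := (hl.isClosed_le hfl').isOpen_compl.inter (hgl'.isClosed_le hl).isOpen_compl
    obtain ⟨x, ⟨hx1, hx2⟩, hxB⟩ := mem_closure_iff.1 hcB _ ho ⟨not_le.2 h1, not_le.2 h2⟩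
    exact hn h' hh' x hxB ⟨not_le.1 hx1, not_le.1 hx2⟩
  · exact graph_ne_cylinder D (hC A' hA').nonempty hfg₁ eA
  · exact graph_ne_cylinder D (hC A' hA').nonempty hfg₁ eA

/-- Finitely many linear functions have constant signs on the members of some special linear
decomposition. -/
theorem exists_isSpecial {n : ℕ} {F : Set ((Fin n → R) → R)} (hF : F.Finite)
    (hl : ∀ f ∈ F, IsLinear D f) :
    ∃ C : Set (Set (Fin n → R)), IsSpecial D C ∧
      ∀ B ∈ C, ∀ f ∈ F, ∀ x ∈ B, ∀ y ∈ B, SameSign (f x) (f y) := by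
  induction n with
  | zero =>
    refine ⟨{Set.univ}, ⟨rfl, fun B hB => hB⟩, fun B _ f _ x _ y _ => ?_⟩
    rw [Subsingleton.elim x y]
    exact SameSign.refl _
  | succ n ih =>
    obtain ⟨G, H, hG, hH, hGl, hHl, hGH⟩ := exists_walls hF hl
    obtain ⟨C, hC, hCs⟩ := ih (F := G ∪ differences H) (hG.union (hH.image2 _ hH)) (by
      rintro f (hf | ⟨h, hh, h', hh', rfl⟩)
      · exact hGl f hf
      · exact (hHl h hh).sub (hHl h' hh'))
    have hCH : OrderedOver C H := fun B hB f hf => hCs B hB f (Or.inr hf)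
    have hcell : ∀ B ∈ C, IsLinearCell D B := fun B hB => hC.isLinearCell hB
    have hcell' : ∀ Z ∈ stackOver C H, IsLinearCell D Z := fun Z hZ =>
      isLinearCell_of_mem_stackOver hcell hHl hZ
    have hproj := projAll_stackOver hcell hH hCH
    refine ⟨stackOver C H, .of_succ ⟨⟨finite_stackOver hC.isDecomposition.finite hH,
      pairwiseDisjoint_stackOver hC.isDecomposition.pairwiseDisjoint hCH, ?_,
      fun Z hZ => (hcell' Z hZ).isCell, hproj.symm ▸ hC.isDecomposition⟩, hcell'⟩
      (hproj.symm ▸ hC) (noCrossing_stackOver hcell hHl), ?_⟩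
    · refine Set.eq_univ_of_forall fun z => ?_
      obtain ⟨B, hB, hz⟩ := hC.isDecomposition.exists_mem (proj z)
      obtain ⟨Z, hZ, hzZ, -⟩ := exists_mem_stackOver D hH hCH hB hz
      exact ⟨Z, hZ, hzZ⟩
    · intro Z hZ f hf z hz w hw
      have hp : proj '' Z ∈ C := hproj ▸ ⟨Z, hZ, rfl⟩
      exact hGH z w (fun g hg => hCs _ hp g (Or.inl hg) _ ⟨z, hz, rfl⟩ _ ⟨w, hw, rfl⟩)
        (fun h hh => sameSign_of_mem_stackOver hcell hHl hCH hZ hz hw hh) f hf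

theorem IsDefinable.exists_isSpecial_partitions {X : Set (Fin n → R)} (hX : IsDefinable D X) :
    ∃ C : Set (Set (Fin n → R)), IsSpecial D C ∧ Partitions C X := by
  obtain ⟨F, hF, hl, hFX⟩ := hX.isSignDetermined
  obtain ⟨C, hC, hs⟩ := exists_isSpecial hF hl
  refine ⟨C, hC, fun B hB => ?_⟩
  by_cases h : ∃ x ∈ B, x ∈ X
  · obtain ⟨x, hxB, hxX⟩ := h
    exact Or.inl fun y hy => hFX x y (fun f hf => hs B hB f hf x hxB y hy) hxX
  · exact Or.inr (Set.disjoint_left.2 fun x hxB hxX => h ⟨x, hxB, hxX⟩)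

end Arrangement

/-! ### Walls of a special linear decomposition -/

section WallsBasic

variable {R : Type v} {n : ℕ} {C : Set (Set (Fin (n + 1) → R))} {A : Set (Fin n → R)}
  {f g : (Fin n → R) → WithBot (WithTop R)}

theorem proj_image_mem {E : Set (Fin (n + 1) → R)}
    (hE : E ∈ C) : proj '' E ∈ projAll C :=
  ⟨E, hE, rfl⟩

/-- The function `f` lies strictly below the set `F`. -/
def LiesBelow [LinearOrder R] (f : (Fin n → R) → WithBot (WithTop R))
    (F : Set (Fin (n + 1) → R)) : Prop :=
  ∀ z ∈ F, f (proj z) < toExt (z (Fin.last n))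

/-- The function `f` lies strictly above the set `F`. -/
def LiesAbove [LinearOrder R] (f : (Fin n → R) → WithBot (WithTop R))
    (F : Set (Fin (n + 1) → R)) : Prop :=
  ∀ z ∈ F, toExt (z (Fin.last n)) < f (proj z)

theorem LiesBelow.of_le [LinearOrder R] {F : Set (Fin (n + 1) → R)} (hg : LiesBelow g F)
    (h : ∀ x ∈ proj '' F, f x ≤ g x) : LiesBelow f F :=
  fun z hz => (h _ ⟨z, hz, rfl⟩).trans_lt (hg z hz)

theorem LiesAbove.of_le [LinearOrder R] {F : Set (Fin (n + 1) → R)} (hf : LiesAbove f F)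
    (h : ∀ x ∈ proj '' F, f x ≤ g x) : LiesAbove g F :=
  fun z hz => (hf z hz).trans_le (h _ ⟨z, hz, rfl⟩)

variable [AddCommGroup R]

/-- A wall of `C` over `A`: one of the constants `±∞` or a linear function whose graph over `A`
belongs to `C`. -/
def IsWall (D : Type u) [DivisionRing D] [Module D R] (C : Set (Set (Fin (n + 1) → R)))
    (A : Set (Fin n → R)) (f : (Fin n → R) → WithBot (WithTop R)) : Prop :=
  (∀ x, f x = ⊥) ∨ (∀ x, f x = ⊤) ∨
    ∃ h : (Fin n → R) → R, IsLinear D h ∧ graph A h ∈ C ∧ ∀ x, f x = toExt (h x)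

variable {D : Type u} [DivisionRing D] [Module D R]

theorem IsWall.isLinearOrInfinite (hf : IsWall D C A f) : IsLinearOrInfinite D f := by
  obtain h | h | ⟨h, hl, -, he⟩ := hf
  · exact Or.inl h
  · exact Or.inr (Or.inl h)
  · exact Or.inr (Or.inr ⟨h, hl, he⟩)

theorem isWall_bot : IsWall D C A fun _ => ⊥ := Or.inl fun _ => rfl

theorem isWall_top : IsWall D C A fun _ => ⊤ := Or.inr (Or.inl fun _ => rfl)

/-- A finite wall over `B` is determined on `B` by its graph, which is one of the finitely many
members of `C`. -/
theorem finite_wall_values {B : Set (Fin n → R)} (hfin : C.Finite) (x : Fin n → R) (hx : x ∈ B) :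
    {e | ∃ f, IsWall D C B f ∧ f x = e}.Finite := by
  refine ((Set.toFinite {(⊥ : WithBot (WithTop R)), ⊤}).union
    (hfin.biUnion (t := fun G => {e | ∃ y, pair x y ∈ G ∧ e = toExt y ∧
      ∃ h : (Fin n → R) → R, G = graph B h}) ?_)).subset ?_
  · intro G _
    refine Set.Subsingleton.finite ?_
    rintro _ ⟨y, hy, rfl, h, rfl⟩ _ ⟨y', hy', rfl, -⟩
    rw [(pair_mem_graph.1 hy).2, (pair_mem_graph.1 hy').2]
  · rintro _ ⟨f, hf | hf | ⟨h, hl, hhC, hf⟩, rfl⟩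
    · exact Or.inl (Or.inl (hf x))
    · exact Or.inl (Or.inr (hf x))
    · exact Or.inr (Set.mem_biUnion hhC ⟨h x, pair_mem_graph.2 ⟨hx, rfl⟩, hf x, h, rfl⟩)

variable [LinearOrder R]

/-- The cell `E` of `C` lies over `A` between the walls `f` and `g`: either it is their common
graph, or it is the cylinder between them. -/
def LiesBetween (D : Type u) [DivisionRing D] [Module D R] (C : Set (Set (Fin (n + 1) → R)))
    (A : Set (Fin n → R)) (E : Set (Fin (n + 1) → R))
    (f g : (Fin n → R) → WithBot (WithTop R)) : Prop :=
  IsWall D C A f ∧ IsWall D C A g ∧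
    ((∃ h, IsLinear D h ∧ E = graph A h ∧ (∀ x, f x = toExt (h x)) ∧ ∀ x, g x = toExt (h x)) ∨
      ((∀ x ∈ A, f x < g x) ∧ E = cylinder A f g))

theorem LiesBetween.le {E : Set (Fin (n + 1) → R)} (hE : LiesBetween D C A E f g)
    {z : Fin (n + 1) → R} (hz : z ∈ E) :
    f (proj z) ≤ toExt (z (Fin.last n)) ∧ toExt (z (Fin.last n)) ≤ g (proj z) := by
  obtain ⟨-, -, ⟨h, -, rfl, hf, hg⟩ | ⟨-, rfl⟩⟩ := hE
  · rw [hf, hg, hz.2]; exact ⟨le_rfl, le_rfl⟩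
  · exact ⟨hz.2.1.le, hz.2.2.le⟩

/-- The decomposition induced on the first `n` coordinates is again special. -/
theorem IsSpecial.base [TopologicalSpace R] (hC : IsSpecial D C) :
    IsSpecial D (projAll C) := by
  cases n with
  | zero =>
    have h : OrderedVectorSpace.projAll C = {Set.univ} := hC.isDecomposition.2.2.2.2
    rw [h]
    exact ⟨rfl, fun _ hB => hB⟩
  | succ n => exact hC.2.1

theorem IsWall.le_of_mem_closure [LinearOrder D] [IsStrictOrderedRing D] [IsOrderedAddMonoid R]
    [IsStrictOrderedModule D R] [TopologicalSpace R] [OrderTopology R] {B : Set (Fin n → R)}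
    (hf : IsWall D C B f) (hg : IsWall D C B g)
    (h : ∀ x ∈ B, f x ≤ g x) (hAB : A ⊆ closure B) : ∀ x ∈ A, f x ≤ g x := fun _ hx =>
  hf.isLinearOrInfinite.le_of_mem_closure hg.isLinearOrInfinite h (hAB hx)

end WallsBasic

section Walls

variable {D : Type u} {R : Type v} [DivisionRing D] [LinearOrder D] [IsStrictOrderedRing D]
  [AddCommGroup R] [LinearOrder R] [IsOrderedAddMonoid R] [Nontrivial R] [Module D R]
  [IsStrictOrderedModule D R] [TopologicalSpace R] {n : ℕ}

/-- In `R ^ 1` the condition holds because distinct cells are disjoint. -/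
theorem IsSpecial.noCrossing {C : Set (Set (Fin (n + 1) → R))} (hC : IsSpecial D C) :
    NoCrossing D C := by
  cases n with
  | zero =>
    rintro A B h f g - - - hfg hA hB ⟨c, ⟨hcA, hcB⟩, h1, h2⟩
    obtain ⟨a, ha⟩ := closure_nonempty_iff.1 ⟨c, hcA⟩
    obtain ⟨b, hb⟩ := closure_nonempty_iff.1 ⟨c, hcB⟩
    rw [Subsingleton.elim a c] at ha
    rw [Subsingleton.elim b c] at hb
    exact graph_ne_cylinder D ⟨c, hb⟩ hfg (hC.isDecomposition.eq_of_mem hA hB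
      (pair_mem_graph.2 ⟨ha, rfl⟩) (pair_mem_cylinder.2 ⟨hb, h1, h2⟩))
  | succ n => exact hC.2.2

variable {C : Set (Set (Fin (n + 1) → R))} {A B : Set (Fin n → R)}
  {f g : (Fin n → R) → WithBot (WithTop R)}

/-- The walls over a cell are linearly ordered: two different ones do not meet, hence, by the
intermediate value property, they do not change their order. -/
theorem IsWall.lt_of_lt (hC : IsSpecial D C) (hA : A ∈ projAll C)
    (hf : IsWall D C A f) (hg : IsWall D C A g) {x y : Fin n → R} (hx : x ∈ A) (hy : y ∈ A)
    (h : f x < g x) : f y < g y := by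
  obtain hf | hf | ⟨f₀, hfl, hfC, hf⟩ := hf
  · obtain hg | hg | ⟨g₀, hgl, hgC, hg⟩ := hg
    · rw [hf, hg] at *; exact h
    · rw [hf, hg] at *; exact h
    · rw [hf, hg]; exact bot_lt_toExt _
  · rw [hf] at h; exact absurd h not_top_lt
  · obtain hg | hg | ⟨g₀, hgl, hgC, hg⟩ := hg
    · rw [hg] at h; exact absurd h not_lt_bot
    · rw [hf, hg]; exact toExt_lt_top _
    · rw [hf, hg, toExt_lt] at *
      have hne : ∀ x ∈ A, f₀ x - g₀ x ≠ 0 := by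
        intro z hz h0
        have := hC.isDecomposition.eq_of_mem hfC hgC (pair_mem_graph.2 ⟨hz, rfl⟩)
          (pair_mem_graph.2 ⟨hz, sub_eq_zero.1 h0⟩)
        exact h.ne (graph_eq_graph_iff.1 this x hx)
      rcases (hfl.sub hgl).pos_or_neg (hC.base.isLinearCell hA) hne with h' | h'
      · exact absurd (h' x hx) (sub_neg.2 h).not_gt
      · exact sub_neg.1 (h' y hy)

theorem IsWall.le_of_le (hC : IsSpecial D C) (hA : A ∈ projAll C)
    (hf : IsWall D C A f) (hg : IsWall D C A g) {x y : Fin n → R} (hx : x ∈ A) (hy : y ∈ A)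
    (h : f x ≤ g x) : f y ≤ g y :=
  not_lt.1 fun h' => h.not_gt (hg.lt_of_lt hC hA hf hy hx h')

theorem IsWall.eq_of_eq (hC : IsSpecial D C) (hA : A ∈ projAll C)
    (hf : IsWall D C A f) (hg : IsWall D C A g) {x y : Fin n → R} (hx : x ∈ A) (hy : y ∈ A)
    (h : f x = g x) : f y = g y :=
  le_antisymm (hf.le_of_le hC hA hg hx hy h.le) (hg.le_of_le hC hA hf hx hy h.ge)

/-- If a linear function never takes its values strictly inside a cylinder of `C` over `A`, it is a
wall over `A`. -/
theorem isWall_of_not_between (hC : IsSpecial D C) (hA : A ∈ projAll C)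
    {f : (Fin n → R) → R} (hf : IsLinear D f)
    (H : ∀ x ∈ A, ∀ p q : (Fin n → R) → WithBot (WithTop R), IsLinearOrInfinite D p →
      IsLinearOrInfinite D q → (∀ x ∈ A, p x < q x) → cylinder A p q ∈ C →
      ¬ (p x < toExt (f x) ∧ toExt (f x) < q x)) :
    IsWall D C A fun x => toExt (f x) := by
  have hd := hC.isDecomposition
  obtain ⟨h, hl, hhC, he⟩ := hf.eq_of_forall_exists_eq (hC.base.isLinearCell hA) hd.finite
    hd.pairwiseDisjoint (fun x hx => by
      obtain ⟨E, hE, hxE⟩ := hd.exists_mem (pair x (f x))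
      have hEA : proj '' E = A := hC.base.isDecomposition.eq_of_mem (proj_image_mem hE) hA
        ⟨_, hxE, proj_pair _ _⟩ hx
      obtain ⟨X, -, ⟨h, hh, rfl⟩ | ⟨p, q, hp, hq, hpq, rfl⟩⟩ := hC.isLinearCell hE
      · rw [proj_image_graph] at hEA
        subst hEA
        exact ⟨h, hh, hE, (pair_mem_graph.1 hxE).2⟩
      · rw [proj_image_cylinder D hpq] at hEA
        subst hEA
        exact absurd (pair_mem_cylinder.1 hxE).2 (H x hx p q hp hq hpq hE))
  exact Or.inr (Or.inr ⟨f, hf, graph_eq_graph_iff.2 he ▸ hhC, fun x => rfl⟩)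

/-- The functions bounding a cylinder of `C` are walls: a cell that crossed one of them would meet
the cylinder. -/
theorem isWall_of_cylinder_mem (hC : IsSpecial D C) (hf : IsLinearOrInfinite D f)
    (hg : IsLinearOrInfinite D g) (hfg : ∀ x ∈ A, f x < g x) (hE : cylinder A f g ∈ C) :
    IsWall D C A f ∧ IsWall D C A g := by
  have := denselyOrdered_of_module D R
  have hA : A ∈ projAll C := proj_image_cylinder D hfg ▸ proj_image_mem hE
  constructor
  · obtain hf | hf | ⟨f₀, hl, hf⟩ := hf
    · exact Or.inl hf
    · exact Or.inr (Or.inl hf)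
    · obtain rfl : f = fun x => toExt (f₀ x) := funext hf
      refine isWall_of_not_between hC hA hl ?_
      rintro x hx p q - - - hpq ⟨h1, h2⟩
      obtain ⟨y, hy1, hy2⟩ := exists_toExt_between (lt_min h2 (hfg x hx))
      have e := hC.isDecomposition.eq_of_mem hpq hE
        (pair_mem_cylinder.2 ⟨hx, h1.trans hy1, hy2.trans_le (min_le_left _ _)⟩)
        (pair_mem_cylinder.2 ⟨hx, hy1, hy2.trans_le (min_le_right _ _)⟩)
      have : pair x (f₀ x) ∈ cylinder A (fun x => toExt (f₀ x)) g :=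
        e ▸ pair_mem_cylinder.2 ⟨hx, h1, h2⟩
      exact lt_irrefl _ (pair_mem_cylinder.1 this).2.1
  · obtain hg | hg | ⟨g₀, hl, hg⟩ := hg
    · exact Or.inl hg
    · exact Or.inr (Or.inl hg)
    · obtain rfl : g = fun x => toExt (g₀ x) := funext hg
      refine isWall_of_not_between hC hA hl ?_
      rintro x hx p q - - - hpq ⟨h1, h2⟩
      obtain ⟨y, hy1, hy2⟩ := exists_toExt_between (max_lt h1 (hfg x hx))
      have e := hC.isDecomposition.eq_of_mem hpq hE
        (pair_mem_cylinder.2 ⟨hx, (le_max_left _ _).trans_lt hy1, hy2.trans h2⟩)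
        (pair_mem_cylinder.2 ⟨hx, (le_max_right _ _).trans_lt hy1, hy2⟩)
      have : pair x (g₀ x) ∈ cylinder A f (fun x => toExt (g₀ x)) :=
        e ▸ pair_mem_cylinder.2 ⟨hx, h1, h2⟩
      exact lt_irrefl _ (pair_mem_cylinder.1 this).2.2

theorem exists_liesBetween (hC : IsSpecial D C) {E : Set (Fin (n + 1) → R)} (hE : E ∈ C) :
    ∃ f g, LiesBetween D C (proj '' E) E f g := by
  obtain ⟨X, -, ⟨h, hh, rfl⟩ | ⟨f, g, hf, hg, hfg, rfl⟩⟩ := hC.isLinearCell hE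
  · rw [proj_image_graph]
    have hw : IsWall D C X fun x => toExt (h x) := Or.inr (Or.inr ⟨h, hh, hE, fun _ => rfl⟩)
    exact ⟨_, _, hw, hw, Or.inl ⟨h, hh, rfl, fun _ => rfl, fun _ => rfl⟩⟩
  · rw [proj_image_cylinder D hfg]
    obtain ⟨hf', hg'⟩ := isWall_of_cylinder_mem hC hf hg hfg hE
    exact ⟨f, g, hf', hg', Or.inr ⟨hfg, rfl⟩⟩

/-- A cylinder of `C` is not crossed by walls. -/
theorem IsWall.le_or_le (hC : IsSpecial D C)
    {w : (Fin n → R) → WithBot (WithTop R)} (hw : IsWall D C A w) (hfg : ∀ x ∈ A, f x < g x)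
    (hE : cylinder A f g ∈ C) {x : Fin n → R} (hx : x ∈ A) : w x ≤ f x ∨ g x ≤ w x := by
  by_contra! h
  obtain hw | hw | ⟨k, hk, hkC, hw⟩ := hw
  · rw [hw] at h; exact not_lt_bot h.1
  · rw [hw] at h; exact not_top_lt h.2
  · rw [hw] at h
    exact graph_ne_cylinder D ⟨x, hx⟩ hfg (hC.isDecomposition.eq_of_mem hkC hE
      (pair_mem_graph.2 ⟨hx, rfl⟩) (pair_mem_cylinder.2 ⟨hx, h⟩))

/-- As walls do not cross cells, a wall below the upper wall of `E` is below `E` itself. -/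
theorem LiesBetween.lt_of_lt_right (hC : IsSpecial D C)
    {E : Set (Fin (n + 1) → R)} (hEC : E ∈ C) (hE : LiesBetween D C A E f g)
    {w : (Fin n → R) → WithBot (WithTop R)} (hw : IsWall D C A w) {z : Fin (n + 1) → R}
    (hz : z ∈ E) (h : w (proj z) < g (proj z)) : w (proj z) < toExt (z (Fin.last n)) := by
  obtain ⟨-, -, ⟨k, -, rfl, hf, hg⟩ | ⟨hfg, rfl⟩⟩ := hE
  · rwa [hg, ← hz.2] at h
  · exact ((hw.le_or_le hC hfg hEC hz.1).resolve_right h.not_ge).trans_lt hz.2.1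

theorem LiesBetween.lt_of_left_lt (hC : IsSpecial D C)
    {E : Set (Fin (n + 1) → R)} (hEC : E ∈ C) (hE : LiesBetween D C A E f g)
    {w : (Fin n → R) → WithBot (WithTop R)} (hw : IsWall D C A w) {z : Fin (n + 1) → R}
    (hz : z ∈ E) (h : f (proj z) < w (proj z)) : toExt (z (Fin.last n)) < w (proj z) := by
  obtain ⟨-, -, ⟨k, -, rfl, hf, hg⟩ | ⟨hfg, rfl⟩⟩ := hE
  · rwa [hf, ← hz.2] at h
  · exact hz.2.2.trans_le ((hw.le_or_le hC hfg hEC hz.1).resolve_left h.not_ge)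

/-- A wall over the base of a cell `F` lies below or above `F`, unless `F` is its graph. -/
theorem IsWall.below_or_above (hC : IsSpecial D C) {F : Set (Fin (n + 1) → R)} (hF : F ∈ C)
    (hf : IsWall D C (proj '' F) f) :
    LiesBelow f F ∨ LiesAbove f F ∨ ∀ z ∈ F, f (proj z) = toExt (z (Fin.last n)) := by
  obtain ⟨p, q, hpq⟩ := exists_liesBetween hC hF
  have hA := proj_image_mem hF
  obtain ⟨w, hw⟩ := (hC.isLinearCell hF).nonempty
  have hwA : proj w ∈ proj '' F := ⟨w, hw, rfl⟩
  by_cases h1 : f (proj w) < q (proj w)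
  · exact Or.inl fun z hz => hpq.lt_of_lt_right hC hF hf hz
      (hf.lt_of_lt hC hA hpq.2.1 hwA ⟨z, hz, rfl⟩ h1)
  · by_cases h2 : p (proj w) < f (proj w)
    · exact Or.inr (Or.inl fun z hz => hpq.lt_of_left_lt hC hF hf hz
        (hpq.1.lt_of_lt hC hA hf hwA ⟨z, hz, rfl⟩ h2))
    · refine Or.inr (Or.inr fun z hz => le_antisymm ?_ ?_)
      · exact (hf.le_of_le hC hA hpq.1 hwA ⟨z, hz, rfl⟩ (not_lt.1 h2)).trans (hpq.le hz).1
      · exact (hpq.le hz).2.trans (hpq.2.1.le_of_le hC hA hf hwA ⟨z, hz, rfl⟩ (not_lt.1 h1))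

/-- A wall over `B` is also a wall over the cells in the closure of `B`. -/
theorem IsWall.restrict (hC : IsSpecial D C) (hA : A ∈ projAll C)
    (hAB : A ⊆ closure B) (hf : IsWall D C B f) : IsWall D C A f := by
  obtain hf | hf | ⟨h, hl, hhC, hf⟩ := hf
  · exact Or.inl hf
  · exact Or.inr (Or.inl hf)
  · obtain rfl : f = fun x => toExt (h x) := funext hf
    refine isWall_of_not_between hC hA hl ?_
    intro x hx p q hp hq hpq hE hx'
    exact hC.noCrossing B A h p q hl hp hq hpq hhC hE
      ⟨x, ⟨hAB hx, subset_closure hx⟩, hx'⟩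

/-- `L` is the largest wall over `B` below `F`. -/
def IsLowerWall (D : Type u) [DivisionRing D] [Module D R] (C : Set (Set (Fin (n + 1) → R)))
    (F : Set (Fin (n + 1) → R)) (B : Set (Fin n → R)) (L : (Fin n → R) → WithBot (WithTop R)) :
    Prop :=
  IsWall D C B L ∧ LiesBelow L F ∧
    ∀ f, IsWall D C B f → LiesBelow f F → ∀ x ∈ B, f x ≤ L x

/-- `U` is the smallest wall over `B` above `F`. -/
def IsUpperWall (D : Type u) [DivisionRing D] [Module D R] (C : Set (Set (Fin (n + 1) → R)))
    (F : Set (Fin (n + 1) → R)) (B : Set (Fin n → R)) (U : (Fin n → R) → WithBot (WithTop R)) :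
    Prop :=
  IsWall D C B U ∧ LiesAbove U F ∧
    ∀ f, IsWall D C B f → LiesAbove f F → ∀ x ∈ B, U x ≤ f x

theorem exists_isLowerWall (hC : IsSpecial D C) (hB : B ∈ projAll C)
    (F : Set (Fin (n + 1) → R)) : ∃ L, IsLowerWall D C F B L := by
  obtain ⟨b, hb⟩ := (hC.base.isLinearCell hB).nonempty
  obtain ⟨e, ⟨L, hL, hLF, rfl⟩, hmax⟩ := Set.exists_max_image
    {e | ∃ f, IsWall D C B f ∧ LiesBelow f F ∧ f b = e} id
    ((finite_wall_values (D := D) hC.isDecomposition.finite b hb).subset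
      (fun e ⟨f, hf, _, he⟩ => ⟨f, hf, he⟩))
    ⟨⊥, fun _ => ⊥, isWall_bot, fun _ _ => bot_lt_toExt _, rfl⟩
  exact ⟨L, hL, hLF, fun f hf hfF x hx =>
    hf.le_of_le hC hB hL hb hx (hmax _ ⟨f, hf, hfF, rfl⟩)⟩

theorem exists_isUpperWall (hC : IsSpecial D C) (hB : B ∈ projAll C)
    (F : Set (Fin (n + 1) → R)) : ∃ U, IsUpperWall D C F B U := by
  obtain ⟨b, hb⟩ := (hC.base.isLinearCell hB).nonempty
  obtain ⟨e, ⟨U, hU, hUF, rfl⟩, hmin⟩ := Set.exists_min_image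
    {e | ∃ f, IsWall D C B f ∧ LiesAbove f F ∧ f b = e} id
    ((finite_wall_values (D := D) hC.isDecomposition.finite b hb).subset
      (fun e ⟨f, hf, _, he⟩ => ⟨f, hf, he⟩))
    ⟨⊤, fun _ => ⊤, isWall_top, fun _ _ => toExt_lt_top _, rfl⟩
  exact ⟨U, hU, hUF, fun f hf hfF x hx =>
    hU.le_of_le hC hB hf hb hx (hmin _ ⟨f, hf, hfF, rfl⟩)⟩

variable [OrderTopology R]

theorem LiesBetween.mem_closure_iff {E : Set (Fin (n + 1) → R)}
    (hE : LiesBetween D C A E f g) {z : Fin (n + 1) → R} :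
    z ∈ closure E ↔ proj z ∈ closure A ∧
      f (proj z) ≤ toExt (z (Fin.last n)) ∧ toExt (z (Fin.last n)) ≤ g (proj z) := by
  obtain ⟨hfw, hgw, ⟨h, hl, rfl, hf, hg⟩ | ⟨hfg, rfl⟩⟩ := hE
  · rw [mem_closure_graph hl, hf, hg, toExt_le, toExt_le, and_congr_right_iff]
    exact fun _ => ⟨fun e => ⟨e.ge, e.le⟩, fun e => le_antisymm e.2 e.1⟩
  · exact mem_closure_cylinder hfw.isLinearOrInfinite hgw.isLinearOrInfinite hfg

/-- A wall over a cell in the closure of `B` is the restriction of a wall over `B`. Near a point of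
its graph there are points of some cell over `B`, and this cell cannot be a cylinder containing
that point strictly between its bounds. -/
theorem IsWall.lift (hC : IsSpecial D C) (hA : A ∈ projAll C)
    (hB : B ∈ projAll C) (hAB : A ⊆ closure B) (hf : IsWall D C A f) :
    ∃ g, IsWall D C B g ∧ ∀ x ∈ A, g x = f x := by
  obtain hf' | hf' | ⟨h, hl, hhC, hf'⟩ := id hf
  · exact ⟨f, Or.inl hf', fun _ _ => rfl⟩
  · exact ⟨f, Or.inr (Or.inl hf'), fun _ _ => rfl⟩
  obtain ⟨c, hc⟩ := (hC.base.isLinearCell hA).nonempty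
  have hmem : pair c (h c) ∈ closure (⋃ E ∈ {E ∈ C | proj '' E = B}, E) := by
    refine map_mem_closure (f := fun x => pair x (h c))
      (continuous_pair continuous_id continuous_const) (hAB hc) fun x hx => ?_
    obtain ⟨E, hE, hxE⟩ := hC.isDecomposition.exists_mem (pair x (h c))
    exact Set.mem_biUnion (show E ∈ {E ∈ C | proj '' E = B} from
      ⟨hE, hC.base.isDecomposition.eq_of_mem (proj_image_mem hE) hB ⟨_, hxE, proj_pair _ _⟩ hx⟩)
      hxE
  rw [(hC.isDecomposition.finite.subset (Set.sep_subset _ _)).closure_biUnion] at hmem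
  obtain ⟨E, ⟨hE, rfl⟩, hcE⟩ := Set.mem_iUnion₂.1 hmem
  obtain ⟨p, q, hpq⟩ := exists_liesBetween hC hE
  have hle := (hpq.mem_closure_iff.1 hcE).2
  rw [proj_pair, pair_last, ← hf'] at hle
  rcases hle.1.eq_or_lt with h1 | h1
  · exact ⟨p, hpq.1, fun x hx => (hpq.1.restrict hC hA hAB).eq_of_eq hC hA hf hc hx h1⟩
  rcases hle.2.eq_or_lt with h2 | h2
  · exact ⟨q, hpq.2.1, fun x hx =>
      (hpq.2.1.restrict hC hA hAB).eq_of_eq hC hA hf hc hx h2.symm⟩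
  exfalso
  obtain ⟨hp, hq, ⟨k, -, -, hpk, hqk⟩ | ⟨hlt, hcyl⟩⟩ := hpq
  · rw [hpk] at h1
    rw [hqk] at h2
    exact lt_asymm h1 h2
  · rw [hcyl] at hE
    rw [hf'] at h1 h2
    exact hC.noCrossing A _ h p q hl hp.isLinearOrInfinite hq.isLinearOrInfinite hlt hhC hE
      ⟨c, ⟨subset_closure hc, hAB hc⟩, h1, h2⟩

end Walls

/-! ### Stars in a special linear decomposition -/

section Stars

variable {D : Type u} {R : Type v} [DivisionRing D] [LinearOrder D] [IsStrictOrderedRing D]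
  [AddCommGroup R] [LinearOrder R] [IsOrderedAddMonoid R] [Nontrivial R] [Module D R]
  [IsStrictOrderedModule D R] [TopologicalSpace R] [OrderTopology R] {n : ℕ}
  {C : Set (Set (Fin (n + 1) → R))} {A B B' : Set (Fin n → R)} {F : Set (Fin (n + 1) → R)}
  {f g L L' U U' : (Fin n → R) → WithBot (WithTop R)}

/-- When the base of `F` is in the closure of the base of `E`, the closure of `E` meets `F` if and
only if the lower wall of `E` is not above `F` and its upper wall is not below `F`; and in this
case it contains `F`. -/
theorem LiesBetween.inter_closure (hC : IsSpecial D C) (hF : F ∈ C) {E : Set (Fin (n + 1) → R)}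
    (hAB : proj '' F ⊆ closure B) (hE : LiesBetween D C B E f g) :
    ((F ∩ closure E).Nonempty → ¬ LiesAbove f F ∧ ¬ LiesBelow g F) ∧
      (¬ LiesAbove f F ∧ ¬ LiesBelow g F → F ⊆ closure E) := by
  constructor
  · rintro ⟨z, hzF, hzE⟩
    have h := (hE.mem_closure_iff.1 hzE).2
    exact ⟨fun h' => (h' z hzF).not_ge h.1, fun h' => (h' z hzF).not_ge h.2⟩
  · rintro ⟨h1, h2⟩ z hz
    refine hE.mem_closure_iff.2 ⟨hAB ⟨z, hz, rfl⟩, ?_, ?_⟩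
    · rcases (hE.1.restrict hC (proj_image_mem hF) hAB).below_or_above hC hF with h | h | h
      · exact (h z hz).le
      · exact absurd h h1
      · exact (h z hz).le
    · rcases (hE.2.1.restrict hC (proj_image_mem hF) hAB).below_or_above hC hF with h | h | h
      · exact absurd h h2
      · exact (h z hz).le
      · exact (h z hz).ge

/-- The frontier condition: in a special linear decomposition, a cell that meets the closure of
another one is contained in it. -/
theorem IsSpecial.subset_closure {n : ℕ} {C : Set (Set (Fin n → R))} (hC : IsSpecial D C)
    {F E : Set (Fin n → R)} (hF : F ∈ C) (hE : E ∈ C) (h : (F ∩ closure E).Nonempty) :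
    F ⊆ closure E := by
  induction n with
  | zero =>
    obtain ⟨z, -, hz⟩ := h
    exact fun w _ => Subsingleton.elim z w ▸ hz
  | succ n ih =>
    obtain ⟨f, g, hfg⟩ := exists_liesBetween hC hE
    have hAB : proj '' F ⊆ closure (proj '' E) := by
      obtain ⟨z, hzF, hzE⟩ := h
      exact ih hC.base (proj_image_mem hF) (proj_image_mem hE)
        ⟨proj z, ⟨z, hzF, rfl⟩, (hfg.mem_closure_iff.1 hzE).1⟩
    have := hfg.inter_closure hC hF hAB
    exact this.2 (this.1 h)

/-- The part of the star of `F` that lies over `B` is the cylinder between the largest wall below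
`F` and the smallest wall above `F`. -/
theorem mem_star_iff (hC : IsSpecial D C) (hF : F ∈ C) (hB : B ∈ projAll C)
    (hAB : proj '' F ⊆ closure B) (hL : IsLowerWall D C F B L) (hU : IsUpperWall D C F B U)
    {z : Fin (n + 1) → R} (hz : proj z ∈ B) :
    z ∈ star C F ↔ L (proj z) < toExt (z (Fin.last n)) ∧ toExt (z (Fin.last n)) < U (proj z) := by
  obtain ⟨E, hE, hzE⟩ := hC.isDecomposition.exists_mem z
  obtain rfl : proj '' E = B := hC.base.isDecomposition.eq_of_mem (proj_image_mem hE) hB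
    ⟨z, hzE, rfl⟩ hz
  obtain ⟨f, g, hfg⟩ := exists_liesBetween hC hE
  have hcl := hfg.inter_closure hC hF hAB
  have hstar : z ∈ star C F ↔ ¬ LiesAbove f F ∧ ¬ LiesBelow g F := by
    constructor
    · rintro ⟨E', ⟨hE', hne⟩, hzE'⟩
      obtain rfl : E' = E := hC.isDecomposition.eq_of_mem hE' hE hzE' hzE
      exact hcl.1 hne
    · intro h
      obtain ⟨w, hw⟩ := (hC.isLinearCell hF).nonempty
      exact ⟨E, ⟨hE, w, hw, hcl.2 h hw⟩, hzE⟩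
  rw [hstar]
  have hle := hfg.le hzE
  constructor
  · rintro ⟨h1, h2⟩
    constructor
    · refine hfg.lt_of_lt_right hC hE hL.1 hzE (not_le.1 fun h => h2 (hL.2.1.of_le ?_))
      exact hfg.2.1.le_of_mem_closure hL.1
        (fun x hx => hfg.2.1.le_of_le hC hB hL.1 hz hx h) hAB
    · refine hfg.lt_of_left_lt hC hE hU.1 hzE (not_le.1 fun h => h1 (hU.2.1.of_le ?_))
      exact hU.1.le_of_mem_closure hfg.1
        (fun x hx => hU.1.le_of_le hC hB hfg.1 hz hx h) hAB
  · rintro ⟨h1, h2⟩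
    exact ⟨fun h => (h2.trans_le (hU.2.2 f hfg.1 h _ hz)).not_ge hle.1,
      fun h => (((hL.2.2 g hfg.2.1 h _ hz).trans_lt h1)).not_ge hle.2⟩

/-- The lower walls of a star over `B'` and over a cell `B` in the closure of `B'` fit together:
walls over `B'` restrict to walls over `B`, and all walls over `B` are such restrictions. -/
theorem IsLowerWall.eq_of_mem_closure (hC : IsSpecial D C) (hB : B ∈ projAll C)
    (hB' : B' ∈ projAll C) (hAB : proj '' F ⊆ closure B) (hBB' : B ⊆ closure B')
    (hL : IsLowerWall D C F B L) (hL' : IsLowerWall D C F B' L') :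
    ∀ x ∈ B, L x = L' x := by
  obtain ⟨g, hg, hgL⟩ := hL.1.lift hC hB hB' hBB'
  have hgF : LiesBelow g F := fun z hz => by
    rw [hg.isLinearOrInfinite.eq_of_mem_closure hL.1.isLinearOrInfinite hgL (hAB ⟨z, hz, rfl⟩)]
    exact hL.2.1 z hz
  intro x hx
  refine le_antisymm ?_ (hL.2.2 L' (hL'.1.restrict hC hB hBB') hL'.2.1 x hx)
  rw [← hgL x hx]
  exact hg.le_of_mem_closure hL'.1 (hL'.2.2 g hg hgF) hBB' x hx

theorem IsUpperWall.eq_of_mem_closure (hC : IsSpecial D C) (hB : B ∈ projAll C)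
    (hB' : B' ∈ projAll C) (hAB : proj '' F ⊆ closure B) (hBB' : B ⊆ closure B')
    (hU : IsUpperWall D C F B U) (hU' : IsUpperWall D C F B' U') :
    ∀ x ∈ B, U x = U' x := by
  obtain ⟨g, hg, hgU⟩ := hU.1.lift hC hB hB' hBB'
  have hgF : LiesAbove g F := fun z hz => by
    rw [hg.isLinearOrInfinite.eq_of_mem_closure hU.1.isLinearOrInfinite hgU (hAB ⟨z, hz, rfl⟩)]
    exact hU.2.1 z hz
  intro x hx
  refine le_antisymm (hU.2.2 U' (hU'.1.restrict hC hB hBB') hU'.2.1 x hx) ?_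
  rw [← hgU x hx]
  exact hU'.1.le_of_mem_closure hg (hU'.2.2 g hg hgF) hBB' x hx

/-- Functions `ℓ B` given on the cells `B` of a star that fit together on the closures of these
cells are the restrictions of a single continuous definable function on the star, or of one of the
constants `±∞`. -/
theorem exists_isContDefOrInfinite {n : ℕ} {C : Set (Set (Fin n → R))} (hC : IsSpecial D C)
    {A : Set (Fin n → R)} (hA : A ∈ C)
    (ℓ : Set (Fin n → R) → (Fin n → R) → WithBot (WithTop R))
    (hl : ∀ B ∈ C, A ⊆ closure B → IsLinearOrInfinite D (ℓ B))
    (hcompat : ∀ B ∈ C, ∀ B' ∈ C, A ⊆ closure B → B ⊆ closure B' → ∀ x ∈ B, ℓ B x = ℓ B' x) :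
    ∃ f, IsContDefOrInfinite D (star C A) f ∧
      ∀ B ∈ C, A ⊆ closure B → ∀ x ∈ B, f x = ℓ B x := by
  have hd := hC.isDecomposition
  obtain ⟨a, ha⟩ := (hC.isLinearCell hA).nonempty
  choose cell hcell hmem using fun x => hd.exists_mem x
  have hcell_eq : ∀ B ∈ C, ∀ x ∈ B, cell x = B := fun B hB x hx =>
    hd.eq_of_mem (hcell x) hB (hmem x) hx
  have hstar : star C A = ⋃ B ∈ {B ∈ C | A ⊆ closure B}, B := by
    ext x
    constructor
    · rintro ⟨B, ⟨hB, hne⟩, hx⟩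
      exact Set.mem_biUnion (show B ∈ {B ∈ C | A ⊆ closure B} from
        ⟨hB, hC.subset_closure hA hB hne⟩) hx
    · intro hx
      obtain ⟨B, ⟨hB, hAB⟩, hx⟩ := Set.mem_iUnion₂.1 hx
      exact ⟨B, ⟨hB, a, ha, hAB ha⟩, hx⟩
  have hAA : A ⊆ closure A := _root_.subset_closure
  have hAl : ∀ B ∈ C, A ⊆ closure B → ℓ B a = ℓ A a := fun B hB hAB =>
    (hcompat A hA B hB hAA hAB a ha).symm
  have hval : ∀ B ∈ C, A ⊆ closure B → ∀ x ∈ B, ℓ (cell x) x = ℓ B x := fun B hB _ x hx => by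
    rw [hcell_eq B hB x hx]
  refine ⟨fun x => ℓ (cell x) x, ?_, hval⟩
  have hstar' : ∀ x ∈ star C A, cell x ∈ C ∧ A ⊆ closure (cell x) := fun x hx => by
    rw [hstar] at hx
    obtain ⟨B, ⟨hB, hAB⟩, hx⟩ := Set.mem_iUnion₂.1 hx
    rw [hcell_eq B hB x hx]
    exact ⟨hB, hAB⟩
  -- which of the three cases holds is decided at the point `a`
  rcases ext_cases (ℓ A a) with h0 | h0 | ⟨y, h0⟩
  · refine Or.inl fun x hx => ?_
    obtain ⟨hB, hAB⟩ := hstar' x hx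
    have e := (hAl _ hB hAB).trans h0
    obtain h | h | ⟨k, -, h⟩ := hl _ hB hAB
    · exact h x
    · rw [h] at e; exact absurd e ext_bot_lt_top.ne'
    · rw [h] at e; exact absurd e (bot_lt_toExt _).ne'
  · refine Or.inr (Or.inl fun x hx => ?_)
    obtain ⟨hB, hAB⟩ := hstar' x hx
    have e := (hAl _ hB hAB).trans h0
    obtain h | h | ⟨k, -, h⟩ := hl _ hB hAB
    · rw [h] at e; exact absurd e ext_bot_lt_top.ne
    · exact h x
    · rw [h] at e; exact absurd e (toExt_lt_top _).ne
  · have hk : ∀ B ∈ C, A ⊆ closure B → ∃ k : (Fin n → R) → R, IsLinear D k ∧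
        ∀ x, ℓ B x = toExt (k x) := fun B hB hAB => by
      have e := (hAl _ hB hAB).trans h0
      obtain h | h | h := hl _ hB hAB
      · rw [h] at e; exact absurd e (bot_lt_toExt _).ne
      · rw [h] at e; exact absurd e (toExt_lt_top _).ne'
      · exact h
    choose! k hkl hk using hk
    have hkval : ∀ B ∈ C, A ⊆ closure B → ∀ x ∈ B, k (cell x) x = k B x := fun B hB _ x hx => by
      rw [hcell_eq B hB x hx]
    refine Or.inr (Or.inr ⟨fun x => k (cell x) x, ⟨?_, ?_⟩, fun x hx => ?_⟩)
    · -- at `x` only the cells whose closure contains `x` matter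
      intro x hx
      obtain ⟨hB, hAB⟩ := hstar' x hx
      rw [hstar]
      rw [ContinuousWithinAt, nhdsWithin_biUnion (hd.finite.subset (Set.sep_subset _ _))]
      simp only [Filter.tendsto_iSup]
      rintro B' ⟨hB', hAB'⟩
      by_cases hx' : x ∈ closure B'
      · have hBB' := hC.subset_closure (hcell x) hB' ⟨x, hmem x, hx'⟩
        refine (hkl B' hB' hAB').continuous.continuousWithinAt.congr
          (fun w hw => hkval B' hB' hAB' w hw) ?_
        have := hcompat _ hB B' hB' hAB hBB' x (hmem x)
        rwa [hk _ hB hAB, hk _ hB' hAB', toExt_inj] at this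
      · have : nhdsWithin x B' = ⊥ := by
          rwa [← Filter.not_neBot, ← mem_closure_iff_nhdsWithin_neBot]
        rw [this]
        exact Filter.tendsto_bot
    · have : graph (star C A) (fun x => k (cell x) x) =
          ⋃ B : {B ∈ C | A ⊆ closure B}, graph B.1 (k B.1) := by
        ext z
        rw [Set.mem_iUnion]
        constructor
        · rintro ⟨hz, he⟩
          obtain ⟨hB, hAB⟩ := hstar' _ hz
          exact ⟨⟨cell (proj z), hB, hAB⟩, hmem _, he⟩
        · rintro ⟨⟨B, hB, hAB⟩, hz, he⟩
          refine ⟨?_, he.trans (hkval B hB hAB _ hz).symm⟩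
          rw [hstar]
          exact Set.mem_biUnion (show B ∈ {B ∈ C | A ⊆ closure B} from ⟨hB, hAB⟩) hz
      have hfin := (hd.finite.subset (Set.sep_subset C fun B => A ⊆ closure B)).to_subtype
      rw [this]
      exact Set.definable_iUnion_of_finite fun B =>
        (hC.isLinearCell B.2.1).isDefinable.graph (hkl B.1 B.2.1 B.2.2)
    · obtain ⟨hB, hAB⟩ := hstar' x hx
      exact hk _ hB hAB x

/-- Stars of cells in a special linear decomposition are open cells. -/
theorem IsSpecial.isOpen_star_and_isCell {n : ℕ} {C : Set (Set (Fin n → R))}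
    (hC : IsSpecial D C) {F : Set (Fin n → R)} (hF : F ∈ C) :
    IsOpen (star C F) ∧ IsCell D (star C F) := by
  induction n with
  | zero =>
    have : star C F = Set.univ := by
      refine Set.eq_univ_of_forall fun x => ?_
      obtain ⟨z, hz⟩ := (hC.isLinearCell hF).nonempty
      exact ⟨F, ⟨hF, z, hz, _root_.subset_closure hz⟩, Subsingleton.elim z x ▸ hz⟩
    exact ⟨this ▸ isOpen_univ, this⟩
  | succ n ih =>
    have hA := proj_image_mem hF
    obtain ⟨hopen, hcell⟩ := ih hC.base hA
    obtain ⟨a, ha⟩ := (hC.base.isLinearCell hA).nonempty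
    choose! L hL using fun B (hB : B ∈ projAll C) => exists_isLowerWall hC hB F
    choose! U hU using fun B (hB : B ∈ projAll C) => exists_isUpperWall hC hB F
    obtain ⟨f, hf, hfL⟩ := exists_isContDefOrInfinite hC.base hA L
      (fun B hB _ => (hL B hB).1.isLinearOrInfinite)
      (fun B hB B' hB' hAB hBB' => (hL B hB).eq_of_mem_closure hC hB hB' hAB hBB' (hL B' hB'))
    obtain ⟨g, hg, hgU⟩ := exists_isContDefOrInfinite hC.base hA U
      (fun B hB _ => (hU B hB).1.isLinearOrInfinite)
      (fun B hB B' hB' hAB hBB' => (hU B hB).eq_of_mem_closure hC hB hB' hAB hBB' (hU B' hB'))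
    have hstar : ∀ {x}, x ∈ star (projAll C) (proj '' F) →
        ∃ B ∈ projAll C, proj '' F ⊆ closure B ∧ x ∈ B := by
      rintro x ⟨B, ⟨hB, hne⟩, hx⟩
      exact ⟨B, hB, hC.base.subset_closure hA hB hne, hx⟩
    have heq : star C F = cylinder (star (projAll C) (proj '' F)) f g := by
      ext z
      have key : proj z ∈ star (projAll C) (proj '' F) → (z ∈ star C F ↔
          f (proj z) < toExt (z (Fin.last n)) ∧ toExt (z (Fin.last n)) < g (proj z)) := by
        intro hz
        obtain ⟨B, hB, hAB, hzB⟩ := hstar hz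
        rw [hfL B hB hAB _ hzB, hgU B hB hAB _ hzB]
        exact mem_star_iff hC hF hB hAB (hL B hB) (hU B hB) hzB
      constructor
      · intro hz
        have hz' : proj z ∈ star (projAll C) (proj '' F) := by
          obtain ⟨E, ⟨hE, w, hwF, hwE⟩, hzE⟩ := hz
          exact ⟨proj '' E, ⟨proj_image_mem hE, proj w, ⟨w, hwF, rfl⟩,
            proj_mem_closure (B := proj '' E) (fun v hv => ⟨v, hv, rfl⟩) hwE⟩, z, hzE, rfl⟩
        exact ⟨hz', (key hz').1 hz⟩
      · exact fun hz => (key hz.1).2 hz.2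
    rw [heq]
    refine ⟨isOpen_cylinder hopen hf hg, _, hcell, Or.inr ⟨f, g, hf, hg, fun x hx => ?_, rfl⟩⟩
    obtain ⟨B, hB, hAB, hxB⟩ := hstar hx
    rw [hfL B hB hAB x hxB, hgU B hB hAB x hxB]
    -- over the base of `F` the cell `F` itself separates the two walls
    obtain ⟨w, hw⟩ := (hC.isLinearCell hF).nonempty
    have hwA : proj w ∈ proj '' F := ⟨w, hw, rfl⟩
    by_contra! hle
    have := (hU B hB).1.le_of_mem_closure (hL B hB).1
      (fun y hy => (hU B hB).1.le_of_le hC hB (hL B hB).1 hxB hy hle) hAB _ hwA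
    exact ((((hL B hB).2.1 w hw).trans ((hU B hB).2.1 w hw))).not_ge this

end Stars
end OrderedVectorSpace

theorem mainTheorem4 {D : Type u} {R : Type v}
    [DivisionRing D] [LinearOrder D] [IsStrictOrderedRing D]
    [AddCommGroup R] [LinearOrder R] [IsOrderedAddMonoid R] [Nontrivial R]
    [Module D R] [IsStrictOrderedModule D R]
    [TopologicalSpace R] [OrderTopology R]
    (n : ℕ) (X : Set (Fin n → R)) (hne : X.Nonempty) (hopen : IsOpen X)
    (hdef : OrderedVectorSpace.IsDefinable D X) :
    (∃ F : Set (Set (Fin n → R)), F.Finite ∧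
      (∀ U ∈ F, IsOpen U ∧ OrderedVectorSpace.IsCell D U) ∧ X = ⋃₀ F) ∧
    (∃ C : Set (Set (Fin n → R)),
      OrderedVectorSpace.IsSpecial D C ∧ OrderedVectorSpace.Partitions C X) ∧
    (∀ C : Set (Set (Fin n → R)),
      OrderedVectorSpace.IsSpecial D C → OrderedVectorSpace.Partitions C X →
      X = (⋃ B ∈ {B ∈ C | B ⊆ X}, OrderedVectorSpace.star C B) ∧
      ∀ B ∈ C, B ⊆ X →
        IsOpen (OrderedVectorSpace.star C B) ∧
          OrderedVectorSpace.IsCell D (OrderedVectorSpace.star C B)) := by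
  open OrderedVectorSpace in
  have key : ∀ C : Set (Set (Fin n → R)), IsSpecial D C → Partitions C X →
      X = (⋃ B ∈ {B ∈ C | B ⊆ X}, star C B) ∧
      ∀ B ∈ C, B ⊆ X → IsOpen (star C B) ∧ IsCell D (star C B) := by
    intro C hC hX
    refine ⟨Set.Subset.antisymm (fun x hx => ?_) (Set.iUnion₂_subset ?_),
      fun B hB _ => hC.isOpen_star_and_isCell hB⟩
    · obtain ⟨B, hB, hxB⟩ := hC.isDecomposition.exists_mem x
      have hBX : B ⊆ X := (hX B hB).resolve_right fun h => Set.disjoint_left.1 h hxB hx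
      exact Set.mem_biUnion (show B ∈ {B ∈ C | B ⊆ X} from ⟨hB, hBX⟩)
        ⟨B, ⟨hB, x, hxB, subset_closure hxB⟩, hxB⟩
    · -- a cell whose closure meets the open set `X` meets `X`, hence is contained in it
      rintro B ⟨-, hBX⟩ x ⟨E, ⟨hE, y, hyB, hyE⟩, hxE⟩
      obtain ⟨w, hwX, hwE⟩ := mem_closure_iff.1 hyE X hopen (hBX hyB)
      exact (hX E hE).resolve_right (fun h => Set.disjoint_left.1 h hwE hwX) hxE
  obtain ⟨C, hC, hCX⟩ := hdef.exists_isSpecial_partitions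
  refine ⟨⟨OrderedVectorSpace.star C '' {B ∈ C | B ⊆ X},
    (hC.isDecomposition.finite.subset (Set.sep_subset _ _)).image _, ?_, ?_⟩, ⟨C, hC, hCX⟩, key⟩
  · rintro _ ⟨B, ⟨hB, hBX⟩, rfl⟩
    exact (key C hC hCX).2 B hB hBX
  · rw [Set.sUnion_image]
    exact (key C hC hCX).1
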